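/- Let $\mu$ be a partition of $m$ and $\nu$ a partition of $n$. Let $s_\kappa=\sum_t x^t$ denote the Schur function of the partition $\kappa$, the sum being over all semistandard $\kappa$-tableaux $t$ with entries from $\mathbf{N}=\{1,2,\ldots\}$. Let $s_\nu\circ s_\mu$ be the plethysm, obtained by substituting the monomials $x^t$, for $t$ a semistandard $\mu$-tableau with entries from $\mathbf N$, for the variables of $s_\nu$, and let $\langle\ ,\ \rangle$ be the inner product on symmetric functions for which the Schur functions are orthonormal. Say that $s_\lambda$ is a constituent of $s_\nu\circ s_\mu$ if $\langle s_\nu\circ s_\mu,s_\lambda\rangle\ge 1$. Order the semistandard $\mu$-tableaux totally by $t<u$ if and only if, in the rightmost column that differs between $t$ and $u$, the greatest entry not appearing in both columns lies in $u$. A plethystic semistandard tableau of shape $\mu^\nu$ is a semistandard $\nu$-tableau $T$ whose entries are semistandard $\mu$-tableaux with entries from $\mathbf N$; its weight is the composition $\beta$ (up to trailing zeros) such that $\beta_b$ is the total number of occurrences of $b$ in the $\mu$-tableau entries of $T$. Compositions $\beta,\gamma$ of the same number are compared by the dominance order: $\beta\unrhd\gamma$ if and only if $\beta_1+\cdots+\beta_i\ge\gamma_1+\cdots+\gamma_i$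 for all $i$. Theorem. (1) The partitions $\lambda$ that are maximal in the dominance order such that $s_\lambda$ is a constituent of $s_\nu\circ s_\mu$ are precisely the maximal weights of the plethystic semistandard tableaux of shape $\mu^\nu$ (in particular these maximal weights are partitions). (2) If $\lambda$ is such a maximal partition, then $\langle s_\nu\circ s_\mu,s_\lambda\rangle$ is the number of plethystic semistandard tableaux of shape $\mu^\nu$ and weight $\lambda$. (3) Let $\kappa=\nu$ if $m$ is even and $\kappa=\nu'$ if $m$ is odd, where $'$ denotes conjugation of partitions. The conjugates $\lambda'$ of the partitions $\lambda$ that are minimal in the dominance order such that $s_\lambda$ is a constituent of $s_\nu\circ s_\mu$ are precisely the maximal weights of the plethystic semistandard tableaux of shape $(\mu')^{\kappa}$; and for such a minimal $\lambda$, $\langle s_\nu\circ s_\mu,s_\lambda\rangle$ is the number of plethystic semistandard tableaux of shape $(\mu')^{\kappa}$ and weight $\lambda'$. -/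

import Mathlib

/-! # Semistandard tableaux, Schur functions, plethysm and the dominance order

A partition is represented by its Young diagram (`YoungDiagram`), with rows and columns numbered
from `0`. The set `{1, 2, 3, …}` of entries of numerical tableaux (and of indices of variables)
is relabelled as `ℕ = {0, 1, 2, …}` by `b ↦ b - 1`. -/

namespace Plethysm

instance boxesFintype (μ : YoungDiagram) : Fintype {c : ℕ × ℕ // c ∈ μ} :=
  Fintype.subtype μ.cells fun c => μ.mem_cells c

/-- A semistandard tableau of shape `μ` with entries in a totally ordered set `B`: a map from the
boxes of `μ` to `B` whose rows weakly increase from left to right and whose columns strictly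
increase from top to bottom. -/
@[ext]
structure SSYT (μ : YoungDiagram) (B : Type*) [LinearOrder B] where
  /-- The entry in each box. -/
  entry : {c : ℕ × ℕ // c ∈ μ} → B
  row_weak : ∀ c c' : {c : ℕ × ℕ // c ∈ μ}, c.1.1 = c'.1.1 → c.1.2 ≤ c'.1.2 → entry c ≤ entry c'
  col_strict : ∀ c c' : {c : ℕ × ℕ // c ∈ μ}, c.1.2 = c'.1.2 → c.1.1 < c'.1.1 → entry c < entry c'

namespace SSYT

variable {μ : YoungDiagram} {B : Type*} [LinearOrder B]

/-- The set of entries of `t` in column `j`. -/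
def col (t : SSYT μ B) (j : ℕ) : Finset B :=
  (Finset.univ.filter fun c : {c : ℕ × ℕ // c ∈ μ} => c.1.2 = j).image t.entry

/-- The order on tableaux: `t < u` if, in the rightmost column `j` that differs between `t` and
`u`, the greatest entry `b` not appearing in both columns lies in `u`. -/
def Lt (t u : SSYT μ B) : Prop :=
  ∃ j, (∀ j', j < j' → t.col j' = u.col j') ∧
    ∃ b, b ∈ u.col j ∧ b ∉ t.col j ∧ ∀ b', b < b' → (b' ∈ t.col j ↔ b' ∈ u.col j)

theorem mem_col {t : SSYT μ B} {j : ℕ} {b : B} :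
    b ∈ t.col j ↔ ∃ c : {c : ℕ × ℕ // c ∈ μ}, c.1.2 = j ∧ t.entry c = b := by
  simp [col]

theorem lt_iff_colex (t u : SSYT μ B) :
    t.Lt u ↔ ∃ j, (∀ j', j < j' → t.col j' = u.col j') ∧
      toColex (t.col j) < toColex (u.col j) := by
  unfold Lt
  refine exists_congr fun j => and_congr_right fun _ => ?_
  rw [Finset.Colex.toColex_lt_toColex_iff_exists_forall_lt]
  constructor
  · rintro ⟨b, h1, h2, h3⟩
    refine ⟨b, h1, h2, fun a ha ha' => ?_⟩
    rcases lt_trichotomy a b with h | h | h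
    · exact h
    · exact absurd ha (h ▸ h2)
    · exact absurd ((h3 a h).1 ha) ha'
  · intro h
    have hne : t.col j ≠ u.col j := by
      rintro he
      obtain ⟨a, ha, ha', -⟩ := h
      exact ha' (he ▸ ha)
    have hlt := Finset.Colex.toColex_lt_toColex_iff_exists_forall_lt.2 h
    obtain ⟨h1, h2⟩ := Finset.Colex.toColex_lt_toColex_iff_max'_mem.1 hlt
    set m := (symmDiff (t.col j) (u.col j)).max' (Finset.symmDiff_nonempty.2 h1)
    have hm : m ∈ symmDiff (t.col j) (u.col j) := Finset.max'_mem _ _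
    refine ⟨m, h2, fun hmt => ?_, fun b' hb' => ?_⟩
    · rcases Finset.mem_symmDiff.1 hm with h | h
      · exact h.2 h2
      · exact h.2 hmt
    · by_contra hc
      have : b' ∈ symmDiff (t.col j) (u.col j) := by
        rw [Finset.mem_symmDiff]; tauto
      exact absurd (Finset.le_max' _ _ this) (not_le.2 hb')

theorem col_strictMono (t : SSYT μ B) (j : ℕ) :
    StrictMono fun i : Fin (μ.colLen j) =>
      t.entry ⟨(i, j), YoungDiagram.mem_iff_lt_colLen.2 i.2⟩ :=
  fun _ _ h => t.col_strict _ _ rfl h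

/-- A semistandard tableau is determined by the sets of entries of its columns. -/
theorem col_injective {t u : SSYT μ B} (h : ∀ j, t.col j = u.col j) : t = u := by
  ext ⟨⟨i, j⟩, hc⟩
  have hrange : ∀ v : SSYT μ B, Set.range (fun i : Fin (μ.colLen j) =>
      v.entry ⟨(i, j), YoungDiagram.mem_iff_lt_colLen.2 i.2⟩) = (v.col j : Set B) := by
    intro v
    ext b
    simp only [Set.mem_range, Finset.mem_coe, mem_col]
    constructor
    · rintro ⟨i, rfl⟩
      exact ⟨_, rfl, rfl⟩
    · rintro ⟨⟨⟨i', j'⟩, hc'⟩, rfl, rfl⟩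
      exact ⟨⟨i', YoungDiagram.mem_iff_lt_colLen.1 hc'⟩, rfl⟩
  have := (StrictMono.range_inj (t.col_strictMono j) (u.col_strictMono j)).1
    (by rw [hrange, hrange, h])
  exact congrFun this ⟨i, YoungDiagram.mem_iff_lt_colLen.1 hc⟩

theorem col_eq_empty (t : SSYT μ B) {j : ℕ} (hj : μ.rowLen 0 ≤ j) : t.col j = ∅ := by
  rw [Finset.eq_empty_iff_forall_notMem]
  intro b hb
  obtain ⟨⟨⟨i, j'⟩, hc⟩, rfl, -⟩ := mem_col.1 hb
  have := YoungDiagram.mem_iff_lt_rowLen.1 hc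
  have := μ.rowLen_anti 0 i (Nat.zero_le _)
  simp only at hj
  omega

theorem lt_trichotomous {t u : SSYT μ B} (h1 : ¬ t.Lt u) (h2 : ¬ u.Lt t) : t = u := by
  by_contra hne
  have hex : ∃ j, t.col j ≠ u.col j := by
    by_contra! hc
    exact hne (col_injective hc)
  obtain ⟨j, hj⟩ := hex
  have hbd : ∀ j, t.col j ≠ u.col j → j ≤ μ.rowLen 0 := by
    intro j hj
    by_contra! hc
    exact hj (by rw [col_eq_empty t hc.le, col_eq_empty u hc.le])
  classical
  set k := Nat.findGreatest (fun j => t.col j ≠ u.col j) (μ.rowLen 0) with hk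
  have hks : t.col k ≠ u.col k :=
    Nat.findGreatest_spec (P := fun j => t.col j ≠ u.col j) (hbd j hj) hj
  have hgt : ∀ j', k < j' → t.col j' = u.col j' := by
    intro j' hj'
    by_contra hc
    exact absurd (Nat.le_findGreatest (P := fun j => t.col j ≠ u.col j) (hbd j' hc) hc)
      (not_le.2 hj')
  rcases lt_trichotomy (toColex (t.col k)) (toColex (u.col k)) with h | h | h
  · exact h1 ((lt_iff_colex _ _).2 ⟨k, hgt, h⟩)
  · exact hks (toColex_inj.1 h)
  · exact h2 ((lt_iff_colex _ _).2 ⟨k, fun j' hj' => (hgt j' hj').symm, h⟩)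

theorem lt_irrefl' (t : SSYT μ B) : ¬ t.Lt t := by
  rintro ⟨_, -, _, h1, h2, -⟩
  exact h2 h1

theorem lt_trans' {t u v : SSYT μ B} (h1 : t.Lt u) (h2 : u.Lt v) : t.Lt v := by
  rw [lt_iff_colex] at *
  obtain ⟨j, hj, hlt⟩ := h1
  obtain ⟨k, hk, hlt'⟩ := h2
  rcases lt_trichotomy j k with h | h | h
  · exact ⟨k, fun j' hj' => (hj j' (h.trans hj')).trans (hk j' hj'), by rwa [hj k h]⟩
  · subst h
    exact ⟨j, fun j' hj' => (hj j' hj').trans (hk j' hj'), hlt.trans hlt'⟩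
  · exact ⟨j, fun j' hj' => (hj j' hj').trans (hk j' (h.trans hj')), by rwa [← hk j h]⟩

/-- Semistandard tableaux of a fixed shape are totally ordered by `SSYT.Lt`. -/
noncomputable instance : LinearOrder (SSYT μ B) :=
  haveI : IsStrictTotalOrder (SSYT μ B) Lt :=
    { trichotomous := fun _ _ h1 h2 => lt_trichotomous h1 h2
      irrefl := lt_irrefl'
      trans := fun _ _ _ => lt_trans' }
  haveI : DecidableRel (Lt : SSYT μ B → SSYT μ B → Prop) := Classical.decRel _
  linearOrderOfSTO Lt

theorem lt_def (t u : SSYT μ B) : t < u ↔ t.Lt u := Iff.rfl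

theorem entry_injective : Function.Injective (SSYT.entry : SSYT μ B → _) :=
  fun _ _ h => SSYT.ext h

instance [Countable B] : Countable (SSYT μ B) :=
  haveI : Countable ({c : ℕ × ℕ // c ∈ μ} → B) := inferInstance
  Function.Injective.countable (entry_injective (μ := μ) (B := B))

/-- The content of a tableau `t` with entries in `B`: the number of occurrences of each `b`. -/
noncomputable def content (t : SSYT μ B) : B →₀ ℕ :=
  ∑ c : {c : ℕ × ℕ // c ∈ μ}, Finsupp.single (t.entry c) 1

end SSYT

/-- Plethystic semistandard tableaux of shape `μ^ν`: semistandard `ν`-tableaux whose entries are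
semistandard `μ`-tableaux with natural number entries. -/
abbrev PSSYT (μ ν : YoungDiagram) : Type := SSYT ν (SSYT μ ℕ)

/-- The weight of a plethystic semistandard tableau: the total number of occurrences of each
number in its tableau entries. (Compositions are recorded up to trailing zeros, as finitely
supported sequences.) -/
noncomputable def PSSYT.wt {μ ν : YoungDiagram} (T : PSSYT μ ν) : ℕ →₀ ℕ :=
  ∑ c : {c : ℕ × ℕ // c ∈ ν}, (T.entry c).content

/-- The Schur function `s_κ = ∑ x^t`, the sum over all semistandard `κ`-tableaux `t` with natural
number entries, as a formal power series in the variables `x_0, x_1, …`. -/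
noncomputable def schur (κ : YoungDiagram) : MvPowerSeries ℕ ℤ :=
  fun β => (Set.ncard {t : SSYT κ ℕ | t.content = β} : ℤ)

/-- An arbitrary numbering of the elements of a countable set. -/
noncomputable def numbering (I : Type*) [Countable I] : I ↪ ℕ :=
  ⟨(Countable.exists_injective_nat I).choose, (Countable.exists_injective_nat I).choose_spec⟩

/-- The result `f(x^{w i} : i ∈ I)` of substituting the monomials `x^{w i}`, `i ∈ I`, for the
variables of a symmetric function `f`. The monomial `x^{w i}` is substituted for the variable
numbered `numbering I i`, and `0` for the variables that are not numbers of elements of `I`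
(as `f` is symmetric, the numbering does not matter). Thus the coefficient of `x^β` is the sum,
over all exponents `α` with `∏ i, (x^{w i})^{α i} = x^β`, of the coefficient of
`∏ i, y_i^{α i}` in `f`. -/
noncomputable def substMonomials {I : Type*} [Countable I] (w : I → ℕ →₀ ℕ)
    (f : MvPowerSeries ℕ ℤ) : MvPowerSeries ℕ ℤ :=
  fun β => ∑ᶠ (α : I →₀ ℕ) (_ : (α.sum fun i k => k • w i) = β),
    MvPowerSeries.coeff (α.embDomain (numbering I)) f

/-- The plethysm `f ∘ s_μ`, obtained by substituting the monomials `x^t`, for `t` a semistandard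
`μ`-tableau with natural number entries, for the variables of `f`. -/
noncomputable def plethysm (f : MvPowerSeries ℕ ℤ) (μ : YoungDiagram) : MvPowerSeries ℕ ℤ :=
  substMonomials (fun t : SSYT μ ℕ => t.content) f

open Classical in
/-- The coefficients of `f` in the basis of Schur functions (and `0` if `f` has no unique
expression as an integral linear combination of Schur functions). -/
noncomputable def schurCoeff (f : MvPowerSeries ℕ ℤ) : YoungDiagram →₀ ℤ :=
  if h : ∃! a : YoungDiagram →₀ ℤ, f = a.sum fun κ z => z • schur κ then h.choose else 0

/-- The inner product on symmetric functions for which the Schur functions are orthonormal. -/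
noncomputable def hallInner (f g : MvPowerSeries ℕ ℤ) : ℤ :=
  (schurCoeff f).sum fun κ z => z * schurCoeff g κ

/-- The partition `κ` as a sequence of parts, followed by zeros. -/
noncomputable def parts (κ : YoungDiagram) : ℕ →₀ ℕ :=
  Finsupp.onFinset (Finset.range (κ.colLen 0)) κ.rowLen fun _ hi =>
    Finset.mem_range.2 (YoungDiagram.mem_iff_lt_colLen.1
      (YoungDiagram.mem_iff_lt_rowLen.2 (Nat.pos_of_ne_zero hi)))

/-- The dominance order on compositions: `β` and `γ` are compositions of the same number and
every partial sum of `β` is at least the corresponding partial sum of `γ`. -/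
def Dominates (β γ : ℕ →₀ ℕ) : Prop :=
  β.degree = γ.degree ∧ ∀ k, ∑ i ∈ Finset.range k, γ i ≤ ∑ i ∈ Finset.range k, β i

/-- The partitions `κ` such that `s_κ` is a constituent of `f`. -/
def constituents (f : MvPowerSeries ℕ ℤ) : Set YoungDiagram :=
  {κ | 1 ≤ hallInner f (schur κ)}

/-- The elements of a set of partitions that are maximal in the dominance order. -/
def maximalPartitions (S : Set YoungDiagram) : Set YoungDiagram :=
  {κ | κ ∈ S ∧ ∀ ρ ∈ S, Dominates (parts ρ) (parts κ) → ρ = κ}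

/-- The elements of a set of partitions that are minimal in the dominance order. -/
def minimalPartitions (S : Set YoungDiagram) : Set YoungDiagram :=
  {κ | κ ∈ S ∧ ∀ ρ ∈ S, Dominates (parts κ) (parts ρ) → ρ = κ}

/-- The maximal weights, in the dominance order, of the plethystic semistandard tableaux of
shape `μ^ν`. -/
def maximalWeights (μ ν : YoungDiagram) : Set (ℕ →₀ ℕ) :=
  {β | (∃ T : PSSYT μ ν, T.wt = β) ∧ ∀ T : PSSYT μ ν, Dominates T.wt β → T.wt = β}

/-- The number of plethystic semistandard tableaux of shape `μ^ν` and weight `β`. -/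
noncomputable def numPSSYT (μ ν : YoungDiagram) (β : ℕ →₀ ℕ) : ℕ :=
  Set.ncard {T : PSSYT μ ν | T.wt = β}

/-- The shape `ν` if `μ` is a partition of an even number, and otherwise its conjugate: the sign
twist of `s_ν ∘ s_μ` is `s_κ ∘ s_{μ'}` where `κ = signTwist μ ν`. -/
def signTwist (μ ν : YoungDiagram) : YoungDiagram :=
  if Even μ.card then ν else ν.transpose

end Plethysm

open Plethysm

namespace Plethysm

open Finset

/-! ### Young diagrams and their row lengths -/

section Rows

/-! The coefficient of `x^β` in the plethysm is the number of plethystic semistandard tableaux of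
weight `β` (`plethysm_apply`). Indeed `s_ν` is symmetric, so its variables may be indexed by the
`μ`-tableaux in any order, in particular in the given total order. The underlying fact is that the
number of tableaux with given content is a matrix entry of a product of operators adding horizontal
strips (`ncard_content_eq`), and that these operators commute (`hMat_comm`).

The plethysm is symmetric and homogeneous, and Kostka matrices are unitriangular for dominance, so
it has a unique expansion with integral Schur coefficients `a κ`. If `κ` is dominance-maximal with
`a κ ≠ 0`, no other term contributes to the monomial with exponent `κ`, and `a κ` is the number of
plethystic tableaux of weight `κ` (`schurSum_parts_of_maximal`). This number is nonnegative, so `a κ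
≥ 1`; positivity of the other coefficients is never needed. Conversely, every exponent that occurs
is dominated by some `κ` with `a κ ≠ 0`. This gives the statements on maximal constituents.

Conjugation reverses dominance, so the statements on minimal constituents follow once conjugating
all Schur functions in `s_ν ∘ s_μ` is known to give `s_κ ∘ s_{μ'}` with `κ = signTwist μ ν`
(`schurSum_transpose_eq_plethysm`). The proof of this passes to two sets of variables, even ones `x`
and odd ones `y`. Letters `x` add horizontal strips and letters `y` vertical strips; a supertableau
is odd if it has an odd number of odd letters. Let `H(z)` and `E(z)` be the generating functions of
the strip operators. The super plethysm is encoded by a product, over supertableaux of shape `μ`, of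
`H` or `E`, according to parity, evaluated at the monomial of the supertableau. Under `y_j = -x_i`
the factors involving `x_i` cancel because `H(z) E(-z) = 1`, so the product is supersymmetric. Super
Schur functions are supersymmetric too, and a supersymmetric series in enough variables is
determined by its part without `y` (`IsSuper.eq_zero`). Hence the Schur expansion of the plethysm in
`x` alone lifts to both sets of variables, and reading it in `y` alone gives the twisted identity.
-/

theorem ext_rowLen {κ ρ : YoungDiagram} (h : ∀ i, κ.rowLen i = ρ.rowLen i) : κ = ρ := by
  ext ⟨i, j⟩
  rw [YoungDiagram.mem_cells, YoungDiagram.mem_cells, YoungDiagram.mem_iff_lt_rowLen,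
    YoungDiagram.mem_iff_lt_rowLen, h]

theorem le_iff_rowLen {κ ρ : YoungDiagram} : κ ≤ ρ ↔ ∀ i, κ.rowLen i ≤ ρ.rowLen i := by
  constructor
  · intro h i
    by_contra! hc
    have h1 : (i, ρ.rowLen i) ∈ κ := YoungDiagram.mem_iff_lt_rowLen.2 hc
    exact lt_irrefl _ (YoungDiagram.mem_iff_lt_rowLen.1 (h h1))
  · rintro h ⟨i, j⟩ hc
    exact YoungDiagram.mem_iff_lt_rowLen.2 ((YoungDiagram.mem_iff_lt_rowLen.1 hc).trans_le (h i))

/-- The Young diagram with a given antitone sequence of row lengths. -/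
def ofRows (f : ℕ → ℕ) (hf : Antitone f) (n : ℕ) : YoungDiagram where
  cells := (range n ×ˢ range (f 0)).filter fun c => c.2 < f c.1
  isLowerSet := by
    rintro ⟨i, j⟩ ⟨i', j'⟩ h hc
    have h1 : i' ≤ i := h.1
    have h2 : j' ≤ j := h.2
    have h3 := hf h1
    simp only [coe_filter, mem_product, mem_range, Set.mem_ofPred_eq] at hc ⊢
    omega

theorem rowLen_ofRows {f : ℕ → ℕ} (hf : Antitone f) {n : ℕ} (hn : f n = 0) (i : ℕ) :
    (ofRows f hf n).rowLen i = f i := by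
  have key : ∀ j, j < (ofRows f hf n).rowLen i ↔ j < f i := by
    intro j
    rw [← YoungDiagram.mem_iff_lt_rowLen, ← YoungDiagram.mem_cells]
    simp only [ofRows, mem_filter, mem_product, mem_range, and_iff_right_iff_imp]
    intro hj
    have h0 := hf (Nat.zero_le i)
    refine ⟨?_, by omega⟩
    by_contra! hc
    have := hf hc
    omega
  have h1 := key (f i)
  have h2 := key ((ofRows f hf n).rowLen i)
  omega

theorem rowLen_colLen_zero (κ : YoungDiagram) {n : ℕ} (hn : κ.colLen 0 ≤ n) :
    κ.rowLen n = 0 := by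
  by_contra hc
  have h1 : (n, 0) ∈ κ := YoungDiagram.mem_iff_lt_rowLen.2 (Nat.pos_of_ne_zero hc)
  have := YoungDiagram.mem_iff_lt_colLen.1 h1
  omega

theorem card_filter_fst_lt (κ : YoungDiagram) (n : ℕ) :
    (κ.cells.filter fun c => c.1 < n).card = ∑ i ∈ range n, κ.rowLen i := by
  rw [card_eq_sum_card_fiberwise (f := Prod.fst) (t := range n)
    (fun c hc => by simpa using (mem_filter.1 hc).2)]
  refine sum_congr rfl fun i hi => ?_
  rw [YoungDiagram.rowLen_eq_card]
  congr 1
  ext c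
  simp only [mem_filter, YoungDiagram.mem_cells, YoungDiagram.mem_row_iff, mem_range] at *
  constructor
  · rintro ⟨⟨h1, _⟩, h2⟩
    exact ⟨h1, h2⟩
  · rintro ⟨h1, h2⟩
    exact ⟨⟨h1, h2 ▸ hi⟩, h2⟩

theorem card_eq_sum_rowLen (κ : YoungDiagram) {n : ℕ} (hn : κ.rowLen n = 0) :
    κ.card = ∑ i ∈ range n, κ.rowLen i := by
  rw [← card_filter_fst_lt, filter_true_of_mem]
  rintro ⟨i, j⟩ hc
  by_contra! h
  have h1 := YoungDiagram.mem_iff_lt_rowLen.1 ((YoungDiagram.mem_cells _).1 hc)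
  have h2 := κ.rowLen_anti n i h
  omega

theorem card_le_of_le {κ ρ : YoungDiagram} (h : κ ≤ ρ) : κ.card ≤ ρ.card :=
  card_le_card (YoungDiagram.cells_subset_iff.2 h)

theorem eq_of_le_of_card {κ ρ : YoungDiagram} (h : κ ≤ ρ) (hc : ρ.card ≤ κ.card) : κ = ρ :=
  YoungDiagram.ext (eq_of_subset_of_card_le (YoungDiagram.cells_subset_iff.2 h) hc)

theorem card_transpose (κ : YoungDiagram) : κ.transpose.card = κ.card := by
  exact card_map (Equiv.prodComm ℕ ℕ).toEmbedding

theorem card_eq_zero_iff {κ : YoungDiagram} : κ.card = 0 ↔ κ = ⊥ := by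
  constructor
  · intro h
    exact (eq_of_le_of_card bot_le (by rw [h]; exact Nat.zero_le _)).symm
  · rintro rfl
    simp [YoungDiagram.card]

theorem transpose_bot : (⊥ : YoungDiagram).transpose = ⊥ := by
  rw [← card_eq_zero_iff, card_transpose, card_eq_zero_iff]

end Rows

/-! ### Horizontal and vertical strips -/

section Strips

/-- `λ / κ` is a horizontal strip. -/
def HStrip (κ l : YoungDiagram) : Prop := κ ≤ l ∧ ∀ i j, (i + 1, j) ∈ l → (i, j) ∈ κ

/-- `λ / κ` is a vertical strip. -/
def VStrip (κ l : YoungDiagram) : Prop := κ ≤ l ∧ ∀ i j, (i, j + 1) ∈ l → (i, j) ∈ κ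

theorem hstrip_transpose {κ l : YoungDiagram} :
    HStrip κ.transpose l.transpose ↔ VStrip κ l := by
  unfold HStrip VStrip
  rw [YoungDiagram.transpose_le_iff]
  simp only [YoungDiagram.mem_transpose, Prod.swap_prod_mk]
  exact and_congr_right fun _ => forall_comm

theorem hstrip_iff {κ l : YoungDiagram} :
    HStrip κ l ↔ ∀ i, κ.rowLen i ≤ l.rowLen i ∧ l.rowLen (i + 1) ≤ κ.rowLen i := by
  unfold HStrip
  rw [le_iff_rowLen, forall_and]
  refine and_congr_right fun _ => forall_congr' fun i => ?_
  simp only [YoungDiagram.mem_iff_lt_rowLen]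
  constructor
  · intro h
    by_contra! hc
    exact lt_irrefl _ (h _ hc)
  · intro h j hj
    omega

theorem vstrip_iff {κ l : YoungDiagram} :
    VStrip κ l ↔ ∀ i, κ.rowLen i ≤ l.rowLen i ∧ l.rowLen i ≤ κ.rowLen i + 1 := by
  unfold VStrip
  rw [le_iff_rowLen, forall_and]
  refine and_congr_right fun _ => forall_congr' fun i => ?_
  simp only [YoungDiagram.mem_iff_lt_rowLen]
  constructor
  · intro h
    by_contra! hc
    exact lt_irrefl _ (h (κ.rowLen i) (by omega))
  · intro h j hj
    omega

theorem HStrip.le {κ l : YoungDiagram} (h : HStrip κ l) : κ ≤ l := h.1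

theorem HStrip.refl (κ : YoungDiagram) : HStrip κ κ :=
  ⟨le_rfl, fun i _ h => κ.up_left_mem (Nat.le_succ i) le_rfl h⟩

/-- The least length of row `i` of a diagram `κ` such that `κ / ρ` and `l / κ` are horizontal
strips. -/
def rowLower (ρ l : YoungDiagram) (i : ℕ) : ℕ := max (ρ.rowLen i) (l.rowLen (i + 1))

/-- The greatest length of row `i` of a diagram `κ` such that `κ / ρ` and `l / κ` are horizontal
strips. -/
def rowUpper (ρ l : YoungDiagram) : ℕ → ℕ
  | 0 => l.rowLen 0
  | i + 1 => min (l.rowLen (i + 1)) (ρ.rowLen i)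

/-- As `max + min` is the sum, the interval bounds of successive rows telescope. This is what makes
reflection in the intervals exchange the sizes of the two strips. -/
theorem rowLower_add_rowUpper (ρ l : YoungDiagram) (i : ℕ) :
    rowLower ρ l i + rowUpper ρ l (i + 1) = ρ.rowLen i + l.rowLen (i + 1) := by
  simp only [rowLower, rowUpper]
  omega

/-- Both strip conditions are interlacing conditions on row lengths, so the rows of `κ` decouple:
each ranges independently over an interval depending only on `ρ` and `l`. -/
theorem between_iff {ρ κ l : YoungDiagram} : (HStrip ρ κ ∧ HStrip κ l) ↔
    ∀ i, rowLower ρ l i ≤ κ.rowLen i ∧ κ.rowLen i ≤ rowUpper ρ l i := by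
  simp only [hstrip_iff]
  constructor
  · rintro ⟨h1, h2⟩ i
    refine ⟨max_le (h1 i).1 (h2 i).2, ?_⟩
    cases i with
    | zero => exact (h2 0).1
    | succ i => exact le_min (h2 _).1 (h1 i).2
  · intro h
    refine ⟨fun i => ⟨(le_max_left _ _).trans (h i).1, (h (i + 1)).2.trans (min_le_right _ _)⟩,
      fun i => ⟨?_, (le_max_right _ _).trans (h i).1⟩⟩
    cases i with
    | zero => exact (h 0).2
    | succ i => exact (h _).2.trans (min_le_left _ _)

/-- The upper bound for row `i + 1` is at most `ρ.rowLen i`, which is at most the lower bound for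
row `i`; hence any choice of lengths in the intervals is a partition. -/
theorem antitone_of_between {ρ l : YoungDiagram} {f : ℕ → ℕ}
    (h : ∀ i, rowLower ρ l i ≤ f i ∧ f i ≤ rowUpper ρ l i) : Antitone f := by
  refine antitone_nat_of_succ_le fun i => ?_
  have h1 := (h (i + 1)).2
  have h2 := (h i).1
  simp only [rowLower, rowUpper] at h1 h2
  omega

theorem rowUpper_le (ρ l : YoungDiagram) (i : ℕ) : rowUpper ρ l i ≤ l.rowLen i := by
  cases i with
  | zero => exact le_rfl
  | succ i => exact min_le_left _ _

theorem exists_between {ρ l : YoungDiagram} {f : ℕ → ℕ}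
    (h : ∀ i, rowLower ρ l i ≤ f i ∧ f i ≤ rowUpper ρ l i) :
    ∃ κ : YoungDiagram, ∀ i, κ.rowLen i = f i := by
  have hn : f (l.colLen 0) = 0 := by
    have h1 := (h (l.colLen 0)).2.trans (rowUpper_le _ _ _)
    rw [rowLen_colLen_zero l le_rfl] at h1
    omega
  exact ⟨_, rowLen_ofRows (antitone_of_between h) hn⟩

/-- The Bender–Knuth involution on the diagrams between `ρ` and `l`. -/
theorem exists_bender_knuth {ρ κ l : YoungDiagram} (h1 : HStrip ρ κ) (h2 : HStrip κ l) :
    ∃ κ' : YoungDiagram, ∀ i, κ'.rowLen i = rowLower ρ l i + rowUpper ρ l i - κ.rowLen i := by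
  refine exists_between (ρ := ρ) (l := l) fun i => ?_
  have := between_iff.1 ⟨h1, h2⟩ i
  omega

/-- Reflecting each row length in its interval stays within the intervals, and summing `rowLower +
rowUpper` over the rows gives `ρ.card + l.card`. So the sizes of the strips `κ / ρ` and `l / κ` are
exchanged. -/
theorem card_bender_knuth {ρ κ κ' l : YoungDiagram} (h1 : HStrip ρ κ) (h2 : HStrip κ l)
    (h : ∀ i, κ'.rowLen i = rowLower ρ l i + rowUpper ρ l i - κ.rowLen i) :
    HStrip ρ κ' ∧ HStrip κ' l ∧ κ'.card + κ.card = ρ.card + l.card := by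
  have hb := between_iff.1 ⟨h1, h2⟩
  rw [← and_assoc]
  refine ⟨between_iff.2 fun i => by have := hb i; have := h i; omega, ?_⟩
  set n := l.colLen 0
  have hl : ∀ k, n ≤ k → l.rowLen k = 0 := fun k hk => rowLen_colLen_zero l hk
  have hκ : κ.rowLen (n + 1) = 0 := by
    have := hl (n + 1) (by omega); have := le_iff_rowLen.1 h2.le (n + 1); omega
  have hρn : ρ.rowLen n = 0 := by
    have := hl n le_rfl
    have := le_iff_rowLen.1 h2.le n
    have := le_iff_rowLen.1 h1.le n
    omega
  have hκ' : κ'.rowLen (n + 1) = 0 := by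
    rw [h, hκ]
    simp only [rowLower, rowUpper, hl (n + 1) (by omega), hl (n + 1 + 1) (by omega)]
    have := ρ.rowLen_anti n (n + 1) (by omega)
    omega
  rw [card_eq_sum_rowLen κ hκ, card_eq_sum_rowLen κ' hκ', ← sum_add_distrib]
  have e1 : ∀ i ∈ range (n + 1), κ'.rowLen i + κ.rowLen i = rowLower ρ l i + rowUpper ρ l i :=
    fun i _ => by have := hb i; have := h i; omega
  rw [sum_congr rfl e1, sum_add_distrib, sum_range_succ, sum_range_succ' (rowUpper ρ l)]
  have e2 : ∀ i ∈ range n, rowLower ρ l i + rowUpper ρ l (i + 1) =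
    ρ.rowLen i + l.rowLen (i + 1) := fun i _ => rowLower_add_rowUpper ρ l i
  have e3 := sum_congr rfl e2
  rw [sum_add_distrib, sum_add_distrib] at e3
  have e4 : rowLower ρ l n = 0 := by simp [rowLower, hρn, hl (n + 1) (by omega)]
  have e5 := card_eq_sum_rowLen ρ hρn
  have e6 := card_eq_sum_rowLen l (hl (n + 1) (by omega))
  rw [sum_range_succ'] at e6
  have e7 : rowUpper ρ l 0 = l.rowLen 0 := rfl
  omega

end Strips

/-! ### The sign-reversing involution on a horizontal strip followed by a vertical strip -/

section Toggle

/-- The involution showing that the signed number of ways to add a horizontal strip to `ρ` and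
then a vertical strip, so as to reach `l ≠ ρ`, is zero. -/
theorem exists_toggle {ρ κ l : YoungDiagram} (h1 : HStrip ρ κ) (h2 : VStrip κ l) {i : ℕ}
    (hi : ρ.rowLen i ≠ l.rowLen i) (hmin : ∀ j < i, ρ.rowLen j = l.rowLen j) :
    ∃ κ' : YoungDiagram, HStrip ρ κ' ∧ VStrip κ' l ∧
      ∀ j, κ'.rowLen j = if j = i then 2 * l.rowLen i - 1 - κ.rowLen i else κ.rowLen j := by
  rw [hstrip_iff] at h1
  rw [vstrip_iff] at h2
  -- The length of row `i` of `κ` is `l.rowLen i` or one less, and the reflection exchanges the two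
  -- values. The smaller one is still at least `ρ.rowLen i` because the rows `i` of `ρ` and `l`
  -- differ.
  set f : ℕ → ℕ := fun j => if j = i then 2 * l.rowLen i - 1 - κ.rowLen i else κ.rowLen j with hf
  have hfi : f i = 2 * l.rowLen i - 1 - κ.rowLen i := if_pos rfl
  have hfj : ∀ j, j ≠ i → f j = κ.rowLen j := fun j hj => if_neg hj
  have hpt : ∀ j, ρ.rowLen j ≤ f j ∧ f j ≤ l.rowLen j ∧ l.rowLen j ≤ f j + 1 := by
    intro j
    have a1 := h1 j
    have a2 := h2 j
    rcases eq_or_ne j i with rfl | hj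
    · rw [hfi]; omega
    · rw [hfj j hj]; omega
  have hnext : ∀ j, f (j + 1) ≤ ρ.rowLen j := by
    intro j
    rcases eq_or_ne (j + 1) i with hj | hj
    -- Here minimality of `i` matters: above row `i` the diagrams `ρ` and `l` agree, so lengthening
    -- row `i` cannot break the horizontal strip condition.
    · rw [hmin j (by omega)]
      exact (hpt _).2.1.trans (l.rowLen_anti _ _ (Nat.le_succ j))
    · rw [hfj _ hj]; exact (h1 j).2
  have hanti : Antitone f := antitone_nat_of_succ_le fun j => (hnext j).trans (hpt j).1
  have hn : f (l.colLen 0) = 0 := by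
    have := (hpt (l.colLen 0)).2.1
    rw [rowLen_colLen_zero l le_rfl] at this
    omega
  have hrow := rowLen_ofRows hanti hn
  refine ⟨ofRows f hanti (l.colLen 0), hstrip_iff.2 fun j => ?_, vstrip_iff.2 fun j => ?_, hrow⟩
  · rw [hrow, hrow]; exact ⟨(hpt j).1, hnext j⟩
  · rw [hrow]; exact (hpt j).2

/-- Only row `i` changes, and by one box, so the toggle changes the sign attached to the size of the
vertical strip. -/
theorem card_toggle {κ κ' l : YoungDiagram} {i : ℕ} (h1 : κ ≤ l) (h2 : κ' ≤ l)
    (hκ : κ.rowLen i = l.rowLen i ∨ κ.rowLen i + 1 = l.rowLen i)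
    (h : ∀ j, κ'.rowLen j = if j = i then 2 * l.rowLen i - 1 - κ.rowLen i else κ.rowLen j)
    (hl : 0 < l.rowLen i) :
    κ'.card = κ.card + 1 ∨ κ.card = κ'.card + 1 := by
  set n := l.colLen 0
  have hln := rowLen_colLen_zero l (le_refl n)
  have hin : i < n := by
    by_contra! hc
    have := rowLen_colLen_zero l hc
    omega
  have a1 := le_iff_rowLen.1 h1 n
  have a2 := le_iff_rowLen.1 h2 n
  rw [card_eq_sum_rowLen κ (n := n) (by omega), card_eq_sum_rowLen κ' (n := n) (by omega),
    ← add_sum_erase _ _ (mem_range.2 hin), ← add_sum_erase _ _ (mem_range.2 hin)]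
  have : ∑ x ∈ (range n).erase i, κ'.rowLen x = ∑ x ∈ (range n).erase i, κ.rowLen x :=
    sum_congr rfl fun j hj => by rw [h, if_neg (ne_of_mem_erase hj)]
  have h3 := h i
  rw [if_pos rfl] at h3
  omega

end Toggle

/-! ### The operators adding strips, on diagrams of bounded size -/

/-- The Young diagrams with at most `M` boxes. -/
abbrev Diag (M : ℕ) : Type := {κ : YoungDiagram // κ.card ≤ M}

theorem mem_range_card {κ : YoungDiagram} {i j : ℕ} (h : (i, j) ∈ κ) :
    i < κ.card ∧ j < κ.card := by
  constructor
  · have h0 : (i, 0) ∈ κ := κ.up_left_mem le_rfl (Nat.zero_le _) h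
    refine (YoungDiagram.mem_iff_lt_colLen.1 h0).trans_le ?_
    rw [YoungDiagram.colLen_eq_card]
    exact card_le_card (filter_subset _ _)
  · have h0 : (0, j) ∈ κ := κ.up_left_mem (Nat.zero_le _) le_rfl h
    refine (YoungDiagram.mem_iff_lt_rowLen.1 h0).trans_le ?_
    rw [YoungDiagram.rowLen_eq_card]
    exact card_le_card (filter_subset _ _)

instance diagFinite (M : ℕ) : Finite (Diag M) := by
  let f : Diag M → ↥(range M ×ˢ range M).powerset := fun κ => ⟨κ.1.cells, by
    rw [mem_powerset]
    rintro ⟨i, j⟩ hc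
    have := mem_range_card ((YoungDiagram.mem_cells _).1 hc)
    have := κ.2
    simp only [mem_product, mem_range]
    omega⟩
  refine Finite.of_injective f fun κ ρ h => Subtype.ext (YoungDiagram.ext ?_)
  exact congrArg Subtype.val h

noncomputable instance diagFintype (M : ℕ) : Fintype (Diag M) := Fintype.ofFinite _

noncomputable instance diagDecidableEq (M : ℕ) : DecidableEq (Diag M) := Classical.decEq _

/-- The empty diagram. -/
def Diag.empty (M : ℕ) : Diag M := ⟨⊥, by simp [YoungDiagram.card]⟩

open Classical in
/-- The operator adding a horizontal strip of size `a`. -/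
noncomputable def hMat (M a : ℕ) : Matrix (Diag M) (Diag M) ℤ :=
  Matrix.of fun l κ => if HStrip κ.1 l.1 ∧ l.1.card = κ.1.card + a then 1 else 0

open Classical in
/-- The operator adding a vertical strip of size `a`. -/
noncomputable def eMat (M a : ℕ) : Matrix (Diag M) (Diag M) ℤ :=
  Matrix.of fun l κ => if VStrip κ.1 l.1 ∧ l.1.card = κ.1.card + a then 1 else 0

theorem hMat_zero (M : ℕ) : hMat M 0 = 1 := by
  ext l κ
  rw [Matrix.one_apply, hMat, Matrix.of_apply]
  congr 1
  rw [eq_iff_iff]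
  constructor
  · rintro ⟨h1, h2⟩
    exact Subtype.ext (eq_of_le_of_card h1.le h2.le).symm
  · rintro rfl
    exact ⟨HStrip.refl _, rfl⟩

/-- Transposition of diagrams. -/
def Diag.transpose {M : ℕ} : Diag M ≃ Diag M where
  toFun κ := ⟨κ.1.transpose, (card_transpose _).trans_le κ.2⟩
  invFun κ := ⟨κ.1.transpose, (card_transpose _).trans_le κ.2⟩
  left_inv _ := Subtype.ext (YoungDiagram.transpose_transpose _)
  right_inv _ := Subtype.ext (YoungDiagram.transpose_transpose _)

theorem eMat_eq (M a : ℕ) :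
    eMat M a = (hMat M a).submatrix Diag.transpose Diag.transpose := by
  ext l κ
  simp only [eMat, hMat, Matrix.of_apply, Matrix.submatrix_apply, Diag.transpose,
    Equiv.coe_fn_mk]
  rw [hstrip_transpose, card_transpose, card_transpose]

theorem hMat_eq_zero {M a : ℕ} (h : M < a) : hMat M a = 0 := by
  ext l κ
  rw [hMat, Matrix.of_apply, if_neg, Matrix.zero_apply]
  rintro ⟨-, h1⟩
  have := l.2
  omega

theorem eMat_eq_zero {M a : ℕ} (h : M < a) : eMat M a = 0 := by
  rw [eMat_eq, hMat_eq_zero h, Matrix.submatrix_zero]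
  rfl

theorem eMat_zero (M : ℕ) : eMat M 0 = 1 := by
  rw [eMat_eq, hMat_zero, Matrix.submatrix_one_equiv]

/-- An entry of the product counts the diagrams between `ρ` and `l` with prescribed strip sizes, and
the Bender–Knuth reflection injects each such set into the one with the sizes exchanged. Bounding
diagrams by `M` boxes loses nothing, as all intermediate diagrams lie inside `l`. -/
theorem hMat_comm (M a b : ℕ) : hMat M a * hMat M b = hMat M b * hMat M a := by
  classical
  have key : ∀ (a b : ℕ) (l ρ : Diag M), (hMat M a * hMat M b) l ρ =
      ((univ.filter fun κ : Diag M => (HStrip ρ.1 κ.1 ∧ HStrip κ.1 l.1) ∧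
        l.1.card = κ.1.card + a ∧ κ.1.card = ρ.1.card + b).card : ℤ) := by
    intro a b l ρ
    rw [Matrix.mul_apply, card_filter, Nat.cast_sum]
    refine sum_congr rfl fun κ _ => ?_
    simp only [hMat, Matrix.of_apply, mul_ite, mul_one, mul_zero, Nat.cast_ite, Nat.cast_one,
      Nat.cast_zero, ← ite_and]
    congr 1
    rw [eq_iff_iff]
    tauto
  have hinj : ∀ (a b : ℕ) (l ρ : Diag M),
      (univ.filter fun κ : Diag M => (HStrip ρ.1 κ.1 ∧ HStrip κ.1 l.1) ∧
        l.1.card = κ.1.card + a ∧ κ.1.card = ρ.1.card + b).card ≤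
      (univ.filter fun κ : Diag M => (HStrip ρ.1 κ.1 ∧ HStrip κ.1 l.1) ∧
        l.1.card = κ.1.card + b ∧ κ.1.card = ρ.1.card + a).card := by
    intro a b l ρ
    have hex : ∀ κ : Diag M, (HStrip ρ.1 κ.1 ∧ HStrip κ.1 l.1) → ∃ κ' : Diag M,
        ∀ i, κ'.1.rowLen i = rowLower ρ.1 l.1 i + rowUpper ρ.1 l.1 i - κ.1.rowLen i := by
      rintro κ ⟨h1, h2⟩
      obtain ⟨κ', h⟩ := exists_bender_knuth h1 h2
      exact ⟨⟨κ', (card_le_of_le (card_bender_knuth h1 h2 h).2.1.le).trans l.2⟩, h⟩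
    choose! g hg using hex
    refine card_le_card_of_injOn g ?_ ?_
    · intro κ hκ
      simp only [coe_filter, mem_univ, true_and, Set.mem_ofPred_eq] at hκ ⊢
      obtain ⟨h1, h2, h3⟩ := card_bender_knuth hκ.1.1 hκ.1.2 (hg κ hκ.1)
      refine ⟨⟨h1, h2⟩, ?_⟩
      omega
    · intro κ hκ κ' hκ' he
      simp only [coe_filter, mem_univ, true_and, Set.mem_ofPred_eq] at hκ hκ'
      refine Subtype.ext (ext_rowLen fun i => ?_)
      have e1 := hg κ hκ.1 i
      have e2 := hg κ' hκ'.1 i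
      have b1 := between_iff.1 hκ.1 i
      have b2 := between_iff.1 hκ'.1 i
      rw [he] at e1
      omega
  ext l ρ
  rw [key, key]
  exact_mod_cast le_antisymm (hinj a b l ρ) (hinj b a l ρ)

/-- The operator form of `∑ (-1)^j e_j h_{d-j} = 0`: all intermediate diagrams cancel in pairs under
the toggle. -/
theorem eMat_hMat (M : ℕ) {d : ℕ} (hd : d ≠ 0) :
    ∑ p ∈ antidiagonal d, (-1) ^ p.2 • (eMat M p.2 * hMat M p.1) = 0 := by
  classical
  ext l ρ
  rw [Matrix.sum_apply, Matrix.zero_apply]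
  simp only [Matrix.smul_apply, Matrix.mul_apply, smul_sum]
  rw [sum_comm]
  -- The intermediate diagram fixes both strip sizes, so at most one pair `p` contributes and the
  -- sum becomes a signed count of diagrams.
  have key : ∀ κ : Diag M, ∑ p ∈ antidiagonal d, (-1 : ℤ) ^ p.2 • (eMat M p.2 l κ * hMat M p.1 κ ρ)
      = if (HStrip ρ.1 κ.1 ∧ VStrip κ.1 l.1) ∧ l.1.card = ρ.1.card + d then
        (-1) ^ (l.1.card - κ.1.card) else 0 := by
    intro κ
    simp only [hMat, eMat, Matrix.of_apply, mul_ite, mul_one, mul_zero, ← ite_and,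
      smul_eq_mul]
    split_ifs with h
    · obtain ⟨⟨h1, h2⟩, h3⟩ := h
      have c1 := card_le_of_le h1.1
      have c2 := card_le_of_le h2.1
      rw [sum_eq_single (κ.1.card - ρ.1.card, l.1.card - κ.1.card)]
      · rw [if_pos]
        refine ⟨⟨h1, ?_⟩, h2, ?_⟩ <;> simp only <;> omega
      · rintro ⟨i, j⟩ hp hne
        rw [if_neg]
        rintro ⟨⟨-, h5⟩, -, h6⟩
        exact hne (by simp only [Prod.mk.injEq]; simp only at h5 h6; omega)
      · intro hc
        exact absurd (HasAntidiagonal.mem_antidiagonal.2 (by simp only; omega)) hc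
    · refine sum_eq_zero fun p hp => if_neg ?_
      rintro ⟨⟨h1, h5⟩, h2, h6⟩
      have := HasAntidiagonal.mem_antidiagonal.1 hp
      exact h ⟨⟨h1, h2⟩, by omega⟩
  rw [sum_congr rfl fun κ _ => key κ, ← sum_filter]
  by_cases hne : ρ.1.rowLen = l.1.rowLen
  · rw [filter_false_of_mem, sum_empty]
    rintro κ - ⟨-, h⟩
    have : ρ = l := Subtype.ext (ext_rowLen fun i => congrFun hne i)
    rw [this] at h
    omega
  -- The row to toggle is the first in which `ρ` and `l` differ. It does not depend on `κ`, so
  -- toggling twice is the identity.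
  obtain ⟨i, hi, hmin⟩ : ∃ i, ρ.1.rowLen i ≠ l.1.rowLen i ∧
      ∀ j < i, ρ.1.rowLen j = l.1.rowLen j := by
    have hex : ∃ i, ρ.1.rowLen i ≠ l.1.rowLen i := by
      by_contra! hc
      exact hne (funext hc)
    refine ⟨Nat.find hex, Nat.find_spec hex, fun j hj => ?_⟩
    by_contra hc
    exact Nat.find_min hex hj hc
  have hex : ∀ κ : Diag M, (HStrip ρ.1 κ.1 ∧ VStrip κ.1 l.1) → ∃ κ' : Diag M,
      (HStrip ρ.1 κ'.1 ∧ VStrip κ'.1 l.1) ∧ ∀ j, κ'.1.rowLen j =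
        if j = i then 2 * l.1.rowLen i - 1 - κ.1.rowLen i else κ.1.rowLen j := by
    rintro κ ⟨h1, h2⟩
    obtain ⟨κ', h3, h4, h⟩ := exists_toggle h1 h2 hi hmin
    exact ⟨⟨κ', (card_le_of_le h4.1).trans l.2⟩, ⟨h3, h4⟩, h⟩
  choose! g hg1 hg2 using hex
  have hrow : ∀ κ : Diag M, (HStrip ρ.1 κ.1 ∧ VStrip κ.1 l.1) →
      (κ.1.rowLen i = l.1.rowLen i ∨ κ.1.rowLen i + 1 = l.1.rowLen i) ∧ 0 < l.1.rowLen i := by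
    rintro κ ⟨h1, h2⟩
    have a1 := hstrip_iff.1 h1 i
    have a2 := vstrip_iff.1 h2 i
    omega
  refine sum_involution (fun κ _ => g κ) ?_ ?_ ?_ ?_
  · intro κ hκ
    have hκ := (mem_filter.1 hκ).2
    have c1 := card_le_of_le hκ.1.2.1
    have c2 := card_le_of_le (hg1 κ hκ.1).2.1
    rcases card_toggle hκ.1.2.1 (hg1 κ hκ.1).2.1 (hrow κ hκ.1).1 (hg2 κ hκ.1) (hrow κ hκ.1).2
      with h | h
    · rw [show l.1.card - κ.1.card = l.1.card - (g κ).1.card + 1 by omega, pow_succ]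
      ring
    · rw [show l.1.card - (g κ).1.card = l.1.card - κ.1.card + 1 by omega, pow_succ]
      ring
  · intro κ hκ _ he
    have hκ := (mem_filter.1 hκ).2
    have h := hg2 κ hκ.1 i
    have := hrow κ hκ.1
    rw [he, if_pos rfl] at h
    omega
  · intro κ hκ
    have hκ := (mem_filter.1 hκ).2
    exact mem_filter.2 ⟨mem_univ _, hg1 κ hκ.1, hκ.2⟩
  · intro κ hκ
    have hκ := (mem_filter.1 hκ).2
    refine Subtype.ext (ext_rowLen fun j => ?_)
    have h1 := hg2 _ (hg1 κ hκ.1) j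
    have h2 := hg2 κ hκ.1
    have := hrow κ hκ.1
    rcases eq_or_ne j i with rfl | hj
    · rw [h1, if_pos rfl, h2, if_pos rfl]
      omega
    · rw [h1, if_neg hj, h2, if_neg hj]

/-! ### The commutative ring generated by the operators -/

/-- The ring generated by the operators adding horizontal strips. -/
def StripRing (M : ℕ) : Type :=
  ↥(Algebra.adjoin ℤ (Set.range (hMat M)))

noncomputable instance stripRingRing (M : ℕ) : Ring (StripRing M) :=
  inferInstanceAs (Ring ↥(Algebra.adjoin ℤ (Set.range (hMat M))))

noncomputable instance stripRingCommRing (M : ℕ) : CommRing (StripRing M) :=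
  { stripRingRing M with
    mul_comm := (Algebra.isMulCommutative_adjoin ℤ (s := Set.range (hMat M)) (by
      rintro _ ⟨a, rfl⟩ _ ⟨b, rfl⟩
      exact hMat_comm M a b)).is_comm.comm }

/-- The elements of the ring as operators. -/
noncomputable def StripRing.val (M : ℕ) : StripRing M →+* Matrix (Diag M) (Diag M) ℤ where
  toFun x := Subtype.val x
  map_one' := rfl
  map_mul' _ _ := rfl
  map_zero' := rfl
  map_add' _ _ := rfl

theorem StripRing.val_injective (M : ℕ) : Function.Injective (StripRing.val M) :=
  Subtype.val_injective

/-- Solving `eMat_hMat` for its term of highest index in `e` expresses each vertical strip operator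
recursively by horizontal ones. Thus vertical strips live in the same commutative ring. -/
theorem eMat_mem (M a : ℕ) : eMat M a ∈ Algebra.adjoin ℤ (Set.range (hMat M)) := by
  induction a using Nat.strong_induction_on with
  | _ a ih =>
    rcases eq_or_ne a 0 with rfl | ha
    · rw [eMat_zero]; exact one_mem _
    have h := eMat_hMat M ha
    have h0 : ((0, a) : ℕ × ℕ) ∈ antidiagonal a := by simp
    rw [← add_sum_erase _ _ h0, hMat_zero, mul_one] at h
    have h1 : eMat M a = -((-1 : ℤ) ^ a • ∑ p ∈ (antidiagonal a).erase (0, a),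
        (-1 : ℤ) ^ p.2 • (eMat M p.2 * hMat M p.1)) := by
      rw [← smul_neg, ← eq_neg_of_add_eq_zero_left h, smul_smul, ← pow_add, ← two_mul, pow_mul]
      simp
    rw [h1]
    refine neg_mem (Subalgebra.smul_mem _ (Subalgebra.sum_mem _ fun p hp => ?_) _)
    refine Subalgebra.smul_mem _ (Subalgebra.mul_mem _ (ih _ ?_)
      (Algebra.subset_adjoin ⟨_, rfl⟩)) _
    obtain ⟨h2, h3⟩ := mem_erase.1 hp
    have h4 := HasAntidiagonal.mem_antidiagonal.1 h3
    by_contra hc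
    exact h2 (Prod.ext (by simp only; omega) (by simp only; omega))

/-- The operator adding a horizontal strip of size `a`, or a vertical strip in the odd case. -/
noncomputable def strip (M : ℕ) (odd : Bool) (a : ℕ) : StripRing M :=
  bif odd then (⟨eMat M a, eMat_mem M a⟩ : ↥(Algebra.adjoin ℤ (Set.range (hMat M))))
  else (⟨hMat M a, Algebra.subset_adjoin ⟨_, rfl⟩⟩ : ↥(Algebra.adjoin ℤ (Set.range (hMat M))))

theorem val_strip_false (M a : ℕ) : StripRing.val M (strip M false a) = hMat M a := rfl

theorem val_strip_true (M a : ℕ) : StripRing.val M (strip M true a) = eMat M a := rfl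

theorem strip_zero (M : ℕ) (o : Bool) : strip M o 0 = 1 := by
  apply StripRing.val_injective
  cases o
  · rw [val_strip_false, hMat_zero, map_one]
  · rw [val_strip_true, eMat_zero, map_one]

theorem strip_eq_zero {M a : ℕ} (o : Bool) (h : M < a) : strip M o a = 0 := by
  apply StripRing.val_injective
  cases o
  · rw [val_strip_false, hMat_eq_zero h, map_zero]
  · rw [val_strip_true, eMat_eq_zero h, map_zero]

theorem sum_strip_mul_strip (M : ℕ) {d : ℕ} (hd : d ≠ 0) :
    ∑ p ∈ antidiagonal d, (-1) ^ p.2 * (strip M false p.1 * strip M true p.2) = 0 := by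
  apply StripRing.val_injective
  rw [map_zero, ← eMat_hMat M hd, map_sum]
  refine sum_congr rfl fun p _ => ?_
  rw [mul_comm (strip M false p.1), map_mul, map_mul, map_pow, map_neg, map_one, val_strip_false,
    val_strip_true]
  rcases Nat.even_or_odd p.2 with h | h <;> simp [h.neg_one_pow]

/-! ### Removing the boxes with the largest entry of a tableau -/

namespace SSYT

variable {κ ρ : YoungDiagram} {B : Type*} [LinearOrder B]

theorem mem_support_content {t : SSYT κ B} {b : B} :
    b ∈ t.content.support ↔ ∃ c, t.entry c = b := by
  classical
  rw [Finsupp.mem_support_iff, content, Finsupp.finsetSum_apply, Ne, sum_eq_zero_iff]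
  simp [Finsupp.single_apply]

theorem degree_content (t : SSYT κ B) : t.content.degree = κ.card := by
  rw [content, map_sum]
  simp only [Finsupp.degree_single, sum_const, smul_eq_mul, mul_one, card_univ]
  exact Fintype.card_of_subtype κ.cells fun c => κ.mem_cells c

theorem finite_content_le (α : B →₀ ℕ) : {t : SSYT κ B | t.content ≤ α}.Finite := by
  have hsub : ∀ t : ↥{t : SSYT κ B | t.content ≤ α}, ∀ c, t.1.entry c ∈ α.support := fun t c => by
    have h1 : t.1.entry c ∈ t.1.content.support := mem_support_content.2 ⟨c, rfl⟩
    exact Finsupp.support_mono t.2 h1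
  let f : ↥{t : SSYT κ B | t.content ≤ α} → ({c : ℕ × ℕ // c ∈ κ} → ↥α.support) :=
    fun t c => ⟨t.1.entry c, hsub t c⟩
  have : Finite ↥{t : SSYT κ B | t.content ≤ α} := by
    refine Finite.of_injective f fun t u h => Subtype.ext (SSYT.ext (funext fun c => ?_))
    exact congrArg Subtype.val (congrFun h c)
  exact Set.toFinite _

theorem finite_content_eq (α : B →₀ ℕ) : {t : SSYT κ B | t.content = α}.Finite :=
  (finite_content_le α).subset fun _ h => le_of_eq h

/-- The boxes with entry less than `b`. -/
def below (t : SSYT κ B) (b : B) : YoungDiagram where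
  cells := (univ.filter fun c => t.entry c < b).map (Function.Embedding.subtype _)
  isLowerSet := by
    rintro ⟨i, j⟩ ⟨i', j'⟩ h hc
    have h1 : i' ≤ i := h.1
    have h2 : j' ≤ j := h.2
    simp only [coe_map, Function.Embedding.subtype_apply, coe_filter, mem_univ, true_and,
      Set.mem_image, Set.mem_ofPred_eq, Subtype.exists, exists_and_right, exists_eq_right] at hc ⊢
    obtain ⟨hm, hlt⟩ := hc
    have hm1 : (i', j) ∈ κ := κ.up_left_mem h1 le_rfl hm
    have hm2 : (i', j') ∈ κ := κ.up_left_mem h1 h2 hm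
    refine ⟨hm2, lt_of_le_of_lt (t.row_weak ⟨_, hm2⟩ ⟨_, hm1⟩ rfl h2) (lt_of_le_of_lt ?_ hlt)⟩
    rcases h1.eq_or_lt with rfl | h1
    · exact le_rfl
    · exact (t.col_strict ⟨_, hm1⟩ ⟨_, hm⟩ rfl h1).le

theorem mem_below {t : SSYT κ B} {b : B} {c : ℕ × ℕ} :
    c ∈ t.below b ↔ ∃ h : c ∈ κ, t.entry ⟨c, h⟩ < b := by
  rw [← YoungDiagram.mem_cells, below]
  simp

/-- The restriction of a tableau to a smaller shape. -/
def restrict (t : SSYT κ B) (h : ρ ≤ κ) : SSYT ρ B where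
  entry c := t.entry ⟨c.1, h c.2⟩
  row_weak c c' := t.row_weak ⟨c.1, h c.2⟩ ⟨c'.1, h c'.2⟩
  col_strict c c' := t.col_strict ⟨c.1, h c.2⟩ ⟨c'.1, h c'.2⟩

open Classical in
/-- The extension of a tableau by a horizontal strip of boxes with entry `b`. -/
def extend (s : SSYT ρ B) (b : B) (h : HStrip ρ κ) (hb : ∀ c, s.entry c < b) : SSYT κ B where
  entry c := if hc : c.1 ∈ ρ then s.entry ⟨c.1, hc⟩ else b
  row_weak c c' h1 h2 := by
    by_cases hc' : c'.1 ∈ ρ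
    · have hc : c.1 ∈ ρ := by
        have := ρ.up_left_mem (i1 := c.1.1) (i2 := c'.1.1) (j1 := c.1.2) (j2 := c'.1.2) h1.le h2 hc'
        exact this
      rw [dif_pos hc, dif_pos hc']
      exact s.row_weak _ _ h1 h2
    · rw [dif_neg hc']
      split_ifs
      · exact (hb _).le
      · exact le_rfl
  col_strict c c' h1 h2 := by
    have hc : c.1 ∈ ρ := by
      have h3 : (c.1.1 + 1, c.1.2) ∈ κ := κ.up_left_mem h2 h1.le c'.2
      exact h.2 _ _ h3
    rw [dif_pos hc]
    split_ifs with hc'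
    · exact s.col_strict _ _ h1 h2
    · exact hb _

theorem below_extend {s : SSYT ρ B} {b : B} {h : HStrip ρ κ} {hb : ∀ c, s.entry c < b} :
    (s.extend b h hb).below b = ρ := by
  ext c
  rw [YoungDiagram.mem_cells, YoungDiagram.mem_cells, mem_below]
  simp only [extend]
  constructor
  · rintro ⟨h1, h2⟩
    by_contra hc
    rw [dif_neg hc] at h2
    exact lt_irrefl _ h2
  · intro hc
    exact ⟨h.le hc, by rw [dif_pos hc]; exact hb _⟩

theorem content_extend {s : SSYT ρ B} {b : B} {h : HStrip ρ κ} {hb : ∀ c, s.entry c < b} :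
    (s.extend b h hb).content = Finsupp.single b (κ.card - ρ.card) + s.content := by
  classical
  have key : ∃ k, (s.extend b h hb).content = Finsupp.single b k + s.content := by
    refine ⟨(univ.filter fun c : {c : ℕ × ℕ // c ∈ κ} => ¬ c.1 ∈ ρ).card, ?_⟩
    rw [content, ← sum_filter_add_sum_filter_not univ (fun c => c.1 ∈ ρ), add_comm]
    congr 1
    · rw [sum_congr rfl (g := fun _ => Finsupp.single b 1), sum_const, Finsupp.smul_single,
        smul_eq_mul, mul_one]
      intro c hc
      simp only [extend]
      rw [dif_neg (mem_filter.1 hc).2]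
    · rw [content]
      refine sum_bij' (fun c hc => ⟨c.1, (mem_filter.1 hc).2⟩) (fun c _ => ⟨c.1, h.le c.2⟩)
        (fun _ _ => mem_univ _) (fun c _ => mem_filter.2 ⟨mem_univ _, c.2⟩) (fun _ _ => rfl)
        (fun _ _ => rfl) fun c hc => ?_
      simp only [extend]
      rw [dif_pos (mem_filter.1 hc).2]
  obtain ⟨k, hk⟩ := key
  -- The multiplicity `k` of the new entry is found by comparing total numbers of boxes.
  have h1 := congrArg Finsupp.degree hk
  rw [map_add, degree_content, degree_content, Finsupp.degree_single] at h1
  rw [hk, h1, Nat.add_sub_cancel]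

theorem extend_injective {b : B} {h : HStrip ρ κ} {s s' : SSYT ρ B} {hb : ∀ c, s.entry c < b}
    {hb' : ∀ c, s'.entry c < b} (he : s.extend b h hb = s'.extend b h hb') : s = s' := by
  ext c
  have h1 := congrFun (congrArg SSYT.entry he) ⟨c.1, h.le c.2⟩
  simp only [extend] at h1
  rw [dif_pos c.2, dif_pos c.2] at h1
  exact h1

/-- Removing the boxes with the largest entry `b` and filling the strip with `b` again are inverse
operations. -/
theorem ncard_below_eq (α : B →₀ ℕ) {b : B} (hα : ∀ c ∈ α.support, c < b) (a : ℕ)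
    (h : HStrip ρ κ) (hc : κ.card = ρ.card + a) :
    {t : SSYT κ B | t.content = Finsupp.single b a + α ∧ t.below b = ρ}.ncard =
      {s : SSYT ρ B | s.content = α}.ncard := by
  have hlt : ∀ s ∈ {s : SSYT ρ B | s.content = α}, ∀ c, s.entry c < b := by
    intro s hs c
    have h1 : s.entry c ∈ s.content.support := mem_support_content.2 ⟨c, rfl⟩
    rw [show s.content = α from hs] at h1
    exact hα _ h1
  symm
  refine Set.ncard_congr (fun s hs => s.extend b h (hlt s hs)) ?_ ?_ ?_
  · intro s hs
    refine ⟨?_, below_extend⟩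
    rw [content_extend, show s.content = α from hs, hc, Nat.add_sub_cancel_left]
  · intro s s' hs hs' he
    exact extend_injective he
  · rintro t ⟨h1, h2⟩
    have hb : ∀ c, (t.restrict h.le).entry c < b := fun c => by
      have h3 : c.1 ∈ t.below b := h2 ▸ c.2
      exact (mem_below.1 h3).2
    have hext : (t.restrict h.le).extend b h hb = t := by
      ext c
      simp only [extend]
      split_ifs with hcρ
      · rfl
      · have h3 : t.entry c ∈ t.content.support := mem_support_content.2 ⟨c, rfl⟩
        rw [h1] at h3
        classical
        rcases Finset.mem_union.1 (Finsupp.support_add h3) with h4 | h4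
        · exact (Finset.mem_singleton.1 (Finsupp.support_single_subset h4)).symm
        · exact absurd (by rw [← h2]; exact mem_below.2 ⟨c.2, hα _ h4⟩) hcρ
    refine ⟨t.restrict h.le, ?_, hext⟩
    have h3 := h1
    rw [← hext, content_extend, hc, Nat.add_sub_cancel_left] at h3
    exact add_left_cancel h3

/-- Columns increase strictly, so the largest entry occurs at most once in each column, at its
bottom. -/
theorem hstrip_below {t : SSYT κ B} {α : B →₀ ℕ} {b : B} (hα : ∀ c ∈ α.support, c < b) {a : ℕ}
    (ht : t.content = Finsupp.single b a + α) :
    HStrip (t.below b) κ ∧ κ.card = (t.below b).card + a := by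
  classical
  have hle : ∀ c, t.entry c ≤ b := by
    intro c
    have h3 : t.entry c ∈ t.content.support := mem_support_content.2 ⟨c, rfl⟩
    rw [ht] at h3
    rcases Finset.mem_union.1 (Finsupp.support_add h3) with h4 | h4
    · exact (Finset.mem_singleton.1 (Finsupp.support_single_subset h4)).le
    · exact (hα _ h4).le
  have hs : HStrip (t.below b) κ := by
    refine ⟨fun c hc => (mem_below.1 hc).1, fun i j h => ?_⟩
    have h1 : (i, j) ∈ κ := κ.up_left_mem (Nat.le_succ i) le_rfl h
    exact mem_below.2 ⟨h1, (t.col_strict ⟨_, h1⟩ ⟨_, h⟩ rfl (Nat.lt_succ_self i)).trans_le (hle _)⟩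
  refine ⟨hs, ?_⟩
  have hb : ∀ c, (t.restrict hs.le).entry c < b := fun c => (mem_below.1 c.2).2
  have hext : (t.restrict hs.le).extend b hs hb = t := by
    ext c
    simp only [extend]
    split_ifs with hcρ
    · rfl
    · refine le_antisymm ?_ (hle c)
      by_contra! hlt
      exact hcρ (mem_below.2 ⟨c.2, hlt⟩)
  have h3 := ht
  rw [← hext, content_extend] at h3
  have h4 := congrArg (fun f => f b) h3
  have h5 : (t.restrict hs.le).content b = 0 := by
    by_contra hne
    obtain ⟨c, hc⟩ := mem_support_content.1 (Finsupp.mem_support_iff.2 hne)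
    exact (hb c).ne hc
  have h6 : α b = 0 := by
    by_contra hne
    exact lt_irrefl b (hα b (Finsupp.mem_support_iff.2 hne))
  simp only [Finsupp.add_apply, Finsupp.single_eq_same, h5, h6] at h4
  have := card_le_of_le hs.le
  omega

end SSYT

/-! ### Tableau counts as matrix entries of products of strip operators -/

variable {B : Type*} [LinearOrder B]

/-- The number of semistandard tableaux of given shape and content, in terms of the operators
adding strips. In particular, it does not depend on the order of the entries. -/
theorem ncard_content_eq {M : ℕ} (κ : Diag M) (α : B →₀ ℕ) :
    ({t : SSYT κ.1 B | t.content = α}.ncard : ℤ) =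
      StripRing.val M (α.prod fun _ a => strip M false a) κ (Diag.empty M) := by
  classical
  -- Removing the largest letter of the tableau corresponds to splitting off one factor of the
  -- operator product. The product itself lives in a commutative ring, so the order of `B`
  -- disappears from the answer.
  induction α using Finsupp.induction_on_max generalizing κ with
  | zero =>
    rw [Finsupp.prod_zero_index, map_one, Matrix.one_apply]
    split_ifs with h
    · subst h
      rw [Nat.cast_eq_one, Set.ncard_eq_one]
      have hemp : IsEmpty {c : ℕ × ℕ // c ∈ (Diag.empty M).1} :=
        ⟨fun c => YoungDiagram.notMem_bot _ c.2⟩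
      refine ⟨⟨fun c => hemp.elim c, fun c => hemp.elim c, fun c => hemp.elim c⟩, ?_⟩
      ext t
      simp only [Set.mem_ofPred_eq, Set.mem_singleton_iff]
      constructor
      · intro _
        ext c
        exact hemp.elim c
      · intro _
        simp [SSYT.content]
    · rw [Nat.cast_eq_zero, Set.ncard_eq_zero (SSYT.finite_content_eq _),
        Set.eq_empty_iff_forall_notMem]
      intro t ht
      have h1 := t.degree_content
      rw [show t.content = 0 from ht, map_zero] at h1
      exact h (Subtype.ext (card_eq_zero_iff.1 h1.symm))
  | single_add b a α hα ha ih =>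
    have hdisj : Disjoint (Finsupp.single b a).support α.support := by
      rw [Finsupp.support_single _ ha, Finset.disjoint_singleton_left]
      exact fun h => lt_irrefl b (hα b h)
    rw [Finsupp.prod_add_index_of_disjoint hdisj, Finsupp.prod_single_index (h := fun _ a => strip M false a) (strip_zero _ _),
      map_mul, Matrix.mul_apply, val_strip_false]
    simp only [hMat, Matrix.of_apply, ite_mul, one_mul, zero_mul]
    have hfin := SSYT.finite_content_eq (κ := κ.1) (Finsupp.single b a + α)
    have hmem : ∀ t ∈ hfin.toFinset, t.below b ∈ (univ : Finset (Diag M)).image Subtype.val := by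
      intro t ht
      have h0 : t.content = Finsupp.single b a + α := hfin.mem_toFinset.1 ht
      have h1 := SSYT.hstrip_below hα h0
      exact mem_image.2 ⟨⟨t.below b, (card_le_of_le h1.1.le).trans κ.2⟩, mem_univ _, rfl⟩
    rw [Set.ncard_eq_toFinset_card _ hfin, card_eq_sum_card_fiberwise hmem,
      sum_image (fun _ _ _ _ h => Subtype.ext h), Nat.cast_sum]
    refine sum_congr rfl fun ρ _ => ?_
    have hset : ((hfin.toFinset.filter fun t => t.below b = ρ.1).card : ℤ) =
        ({t : SSYT κ.1 B | t.content = Finsupp.single b a + α ∧ t.below b = ρ.1}.ncard : ℤ) := by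
      rw [← Set.ncard_coe_finset]
      congr 2
      ext t
      simp
    rw [hset]
    split_ifs with h
    · rw [SSYT.ncard_below_eq α hα a h.1 h.2, ih]
    · rw [Nat.cast_eq_zero, Set.ncard_eq_zero (hfin.subset fun t ht => ht.1),
        Set.eq_empty_iff_forall_notMem]
      rintro t ⟨h1, h2⟩
      exact h (h2 ▸ SSYT.hstrip_below hα h1)

/-- The operators for the transposed diagrams. -/
theorem ncard_content_transpose_eq {M : ℕ} (κ : Diag M) (α : B →₀ ℕ) :
    ({t : SSYT κ.1.transpose B | t.content = α}.ncard : ℤ) =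
      StripRing.val M (α.prod fun _ a => strip M true a) κ (Diag.empty M) := by
  have h := ncard_content_eq (Diag.transpose κ) α
  refine h.trans ?_
  -- Relabelling rows and columns by transposition is multiplicative on matrices and turns
  -- horizontal strip operators into vertical ones.
  have key : (StripRing.val M (α.prod fun _ a => strip M true a)) =
      (StripRing.val M (α.prod fun _ a => strip M false a)).submatrix
        Diag.transpose Diag.transpose := by
    induction α using Finsupp.induction_on_max with
    | zero =>
      rw [Finsupp.prod_zero_index, Finsupp.prod_zero_index, map_one, Matrix.submatrix_one_equiv]
    | single_add b a α hα ha ih =>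
      have hdisj : Disjoint (Finsupp.single b a).support α.support := by
        rw [Finsupp.support_single _ ha, Finset.disjoint_singleton_left]
        exact fun h => lt_irrefl b (hα b h)
      rw [Finsupp.prod_add_index_of_disjoint hdisj,
        Finsupp.prod_single_index (h := fun _ a => strip M true a) (strip_zero _ _),
        Finsupp.prod_add_index_of_disjoint hdisj,
        Finsupp.prod_single_index (h := fun _ a => strip M false a) (strip_zero _ _),
        map_mul, map_mul, ih (ncard_content_eq _ α), val_strip_true, val_strip_false, eMat_eq,
        Matrix.submatrix_mul_equiv]
  rw [key, Matrix.submatrix_apply]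
  rw [show Diag.transpose (Diag.empty M) = Diag.empty M from Subtype.ext transpose_bot]

/-! ### The dominance order -/

theorem degree_eq_sum_range {β : ℕ →₀ ℕ} {n : ℕ} (h : β.support ⊆ range n) :
    β.degree = ∑ i ∈ range n, β i := by
  rw [Finsupp.degree_apply]
  exact sum_subset h fun i _ hi => Finsupp.notMem_support_iff.1 hi

theorem exists_support_subset_range (β : ℕ →₀ ℕ) : ∃ n, β.support ⊆ range n :=
  β.support.exists_nat_subset_range

theorem sum_range_le_degree (β : ℕ →₀ ℕ) (k : ℕ) : ∑ i ∈ range k, β i ≤ β.degree := by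
  obtain ⟨n, hn⟩ := exists_support_subset_range β
  rw [degree_eq_sum_range (n := max n k) (hn.trans (range_subset_range.2 (le_max_left _ _)))]
  exact sum_le_sum_of_subset (range_subset_range.2 (le_max_right _ _))

namespace Dominates

variable {β γ δ : ℕ →₀ ℕ}

theorem refl (β : ℕ →₀ ℕ) : Dominates β β := ⟨rfl, fun _ => le_rfl⟩

theorem trans (h1 : Dominates β γ) (h2 : Dominates γ δ) : Dominates β δ :=
  ⟨h1.1.trans h2.1, fun k => (h2.2 k).trans (h1.2 k)⟩

theorem antisymm (h1 : Dominates β γ) (h2 : Dominates γ β) : β = γ := by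
  ext i
  have e1 := le_antisymm (h1.2 i) (h2.2 i)
  have e2 := le_antisymm (h1.2 (i + 1)) (h2.2 (i + 1))
  rw [sum_range_succ, sum_range_succ, e1] at e2
  omega

/-- The lexicographic order linearly extends dominance: at the first differing entry the partial
sums compare as the entries do. It serves for triangularity and for picking maximal elements. -/
theorem toLex_le (h : Dominates β γ) : toLex γ ≤ toLex β := by
  by_contra! hc
  obtain ⟨i, h1, h2⟩ := Finsupp.Lex.lt_iff.1 hc
  have h3 := h.2 (i + 1)
  have h4 : ∑ j ∈ range i, β j = ∑ j ∈ range i, γ j :=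
    sum_congr rfl fun j hj => h1 j (mem_range.1 hj)
  rw [sum_range_succ, sum_range_succ] at h3
  simp only [ofLex_toLex] at h2
  omega

end Dominates

theorem parts_apply (κ : YoungDiagram) (i : ℕ) : parts κ i = κ.rowLen i := rfl

theorem parts_injective : Function.Injective parts :=
  fun _ _ h => ext_rowLen fun i => DFunLike.congr_fun h i

theorem sum_range_parts (κ : YoungDiagram) (k : ℕ) :
    ∑ i ∈ range k, parts κ i = (κ.cells.filter fun c => c.1 < k).card :=
  (card_filter_fst_lt κ k).symm

theorem degree_parts (κ : YoungDiagram) : (parts κ).degree = κ.card := by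
  obtain ⟨n, hn⟩ := exists_support_subset_range (parts κ)
  have h0 : κ.rowLen n = 0 := by
    by_contra hc
    exact absurd (hn (Finsupp.mem_support_iff.2 hc)) (by simp)
  rw [degree_eq_sum_range hn, card_eq_sum_rowLen κ h0]
  rfl

theorem exists_parts_eq {β : ℕ →₀ ℕ} (h : ∀ i, β (i + 1) ≤ β i) : ∃ κ, parts κ = β := by
  obtain ⟨n, hn⟩ := exists_support_subset_range β
  have h0 : β n = 0 := by
    by_contra hc
    exact absurd (hn (Finsupp.mem_support_iff.2 hc)) (by simp)
  exact ⟨ofRows β (antitone_nat_of_succ_le h) n, Finsupp.ext fun i => rowLen_ofRows _ h0 i⟩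

/-! ### Symmetric functions and sorting of exponents -/

/-- A power series is symmetric if its coefficients are invariant under permutations of the
variables. -/
def IsSymm (F : (ℕ →₀ ℕ) → ℤ) : Prop :=
  ∀ (σ : Equiv.Perm ℕ) (β : ℕ →₀ ℕ), F (Finsupp.equivMapDomain σ β) = F β

/-- Exchanging entries `i` and `i + 1` alters only the partial sum of length `i + 1`. -/
theorem sum_range_swap {β β' : ℕ →₀ ℕ} {i : ℕ} (h1 : β' i = β (i + 1)) (h2 : β' (i + 1) = β i)
    (h : ∀ j, j ≠ i → j ≠ i + 1 → β' j = β j) (k : ℕ) :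
    ∑ j ∈ range k, β' j + (if k = i + 1 then β i else 0) =
      ∑ j ∈ range k, β j + (if k = i + 1 then β (i + 1) else 0) := by
  induction k with
  | zero => simp
  | succ k ih =>
    rw [sum_range_succ, sum_range_succ]
    rcases lt_trichotomy k i with hk | hk | hk
    · rw [h k (by omega) (by omega)]
      rw [if_neg (by omega), if_neg (by omega)] at ih ⊢
      omega
    · subst hk
      rw [if_pos rfl, if_pos rfl, h1]
      rw [if_neg (by omega), if_neg (by omega)] at ih
      omega
    · rw [if_neg (by omega), if_neg (by omega)]
      rcases eq_or_ne k (i + 1) with rfl | hk'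
      · rw [if_pos rfl, if_pos rfl] at ih
        rw [h2]
        omega
      · rw [h k (by omega) hk']
        rw [if_neg hk', if_neg hk'] at ih
        omega

/-- Sorting the exponents gives a partition which dominates them. -/
theorem exists_sorted (β : ℕ →₀ ℕ) :
    ∃ κ, Dominates (parts κ) β ∧ ∀ F, IsSymm F → F (parts κ) = F β := by
  obtain ⟨n, hn⟩ := exists_support_subset_range β
  -- The induction measure for bubble sort: each exchange of an adjacent ascent raises the sum of
  -- the first `n` partial sums, which never exceeds `n * β.degree`.
  obtain ⟨r, hr⟩ : ∃ r, r = (n * β.degree - ∑ k ∈ range n, ∑ j ∈ range k, β j) := ⟨_, rfl⟩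
  induction r using Nat.strong_induction_on generalizing β with
  | _ r ih =>
    by_cases hanti : ∀ i, β (i + 1) ≤ β i
    · obtain ⟨κ, rfl⟩ := exists_parts_eq hanti
      exact ⟨κ, Dominates.refl _, fun _ _ => rfl⟩
    push Not at hanti
    obtain ⟨i, hi⟩ := hanti
    set σ := Equiv.swap i (i + 1) with hσ
    set β' := Finsupp.equivMapDomain σ β with hβ'
    have happ : ∀ j, β' j = β (σ j) := fun j => by
      rw [hβ', Finsupp.equivMapDomain_apply, hσ, Equiv.symm_swap]
    have h1 : β' i = β (i + 1) := by rw [happ, hσ, Equiv.swap_apply_left]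
    have h2 : β' (i + 1) = β i := by rw [happ, hσ, Equiv.swap_apply_right]
    have h3 : ∀ j, j ≠ i → j ≠ i + 1 → β' j = β j := fun j hj hj' => by
      rw [happ, hσ, Equiv.swap_apply_of_ne_of_ne hj hj']
    have hdeg : β'.degree = β.degree := by
      rw [hβ', Finsupp.equivMapDomain_eq_mapDomain, Finsupp.degree_mapDomain]
    have hin : i + 1 < n := by
      refine mem_range.1 (hn (Finsupp.mem_support_iff.2 ?_))
      omega
    have hsupp : β'.support ⊆ range n := by
      intro j hj
      rw [Finsupp.mem_support_iff] at hj
      rw [mem_range]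
      by_contra hc
      rw [h3 j (by omega) (by omega)] at hj
      exact hc (mem_range.1 (hn (Finsupp.mem_support_iff.2 hj)))
    have hsum := sum_range_swap h1 h2 h3
    have hdom : Dominates β' β := by
      refine ⟨hdeg, fun k => ?_⟩
      have := hsum k
      split_ifs at this <;> omega
    have hlt : ∑ k ∈ range n, ∑ j ∈ range k, β j < ∑ k ∈ range n, ∑ j ∈ range k, β' j := by
      refine sum_lt_sum (fun k _ => hdom.2 k) ⟨i + 1, mem_range.2 hin, ?_⟩
      have := hsum (i + 1)
      rw [if_pos rfl, if_pos rfl] at this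
      omega
    have hle : ∑ k ∈ range n, ∑ j ∈ range k, β' j ≤ n * β'.degree := by
      refine (sum_le_sum fun k _ => sum_range_le_degree β' k).trans ?_
      simp
    rw [hdeg] at hle
    obtain ⟨κ, h4, h5⟩ := ih _ (by rw [hr, hdeg]; omega) β' hsupp rfl
    exact ⟨κ, h4.trans hdom, fun F hF => (h5 F hF).trans (hF σ β)⟩

/-! ### Kostka numbers -/

section Kostka

variable {κ : YoungDiagram}

/-- The number of semistandard tableaux of shape `κ` and content `β`. -/
noncomputable def kostka (κ : YoungDiagram) (β : ℕ →₀ ℕ) : ℕ :=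
  {t : SSYT κ ℕ | t.content = β}.ncard

theorem schur_apply (κ : YoungDiagram) (β : ℕ →₀ ℕ) : schur κ β = (kostka κ β : ℤ) := rfl

theorem exists_of_kostka_ne_zero {β : ℕ →₀ ℕ} (h : kostka κ β ≠ 0) :
    ∃ t : SSYT κ ℕ, t.content = β :=
  Set.nonempty_of_ncard_ne_zero h

theorem degree_of_kostka_ne_zero {β : ℕ →₀ ℕ} (h : kostka κ β ≠ 0) : β.degree = κ.card := by
  obtain ⟨t, rfl⟩ := exists_of_kostka_ne_zero h
  exact t.degree_content

/-- Permuting the content only permutes the factors of a product in a commutative ring. -/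
theorem isSymm_schur (κ : YoungDiagram) : IsSymm (schur κ) := by
  intro σ β
  have h1 := ncard_content_eq (M := κ.card) ⟨κ, le_rfl⟩ β
  have h2 := ncard_content_eq (M := κ.card) ⟨κ, le_rfl⟩ (Finsupp.equivMapDomain σ β)
  rw [Finsupp.prod_equivMapDomain] at h2
  exact h2.trans h1.symm

namespace SSYT

theorem fst_le_entry (t : SSYT κ ℕ) (c : {c : ℕ × ℕ // c ∈ κ}) : c.1.1 ≤ t.entry c := by
  obtain ⟨⟨i, j⟩, hc⟩ := c
  induction i with
  | zero => exact Nat.zero_le _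
  | succ i ih =>
    have h1 : (i, j) ∈ κ := κ.up_left_mem (Nat.le_succ i) le_rfl hc
    have h2 := ih h1
    have h3 := t.col_strict ⟨_, h1⟩ ⟨_, hc⟩ rfl (Nat.lt_succ_self i)
    simp only at h2 ⊢
    omega

theorem content_apply (t : SSYT κ ℕ) (b : ℕ) :
    t.content b = (univ.filter fun c => t.entry c = b).card := by
  rw [content, Finsupp.finsetSum_apply, card_filter]
  exact sum_congr rfl fun c _ => Finsupp.single_apply

theorem sum_range_content (t : SSYT κ ℕ) (k : ℕ) :
    ∑ b ∈ range k, t.content b = (univ.filter fun c => t.entry c < k).card := by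
  rw [card_eq_sum_card_fiberwise (f := t.entry) (t := range k)
    (fun c hc => by simpa using hc)]
  refine sum_congr rfl fun b hb => ?_
  rw [content_apply, filter_filter]
  congr 1
  ext c
  simp only [mem_filter, mem_univ, true_and, mem_range] at hb ⊢
  omega

theorem sum_range_parts' (κ : YoungDiagram) (k : ℕ) : ∑ i ∈ range k, parts κ i =
    (univ.filter fun c : {c : ℕ × ℕ // c ∈ κ} => c.1.1 < k).card := by
  rw [sum_range_parts, ← card_map (Function.Embedding.subtype (· ∈ κ))]
  congr 1
  ext c
  simp [and_comm]

theorem filter_subset_filter (t : SSYT κ ℕ) (k : ℕ) :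
    (univ.filter fun c => t.entry c < k) ⊆
      univ.filter fun c : {c : ℕ × ℕ // c ∈ κ} => c.1.1 < k := by
  intro c hc
  simp only [mem_filter, mem_univ, true_and] at hc ⊢
  exact (t.fst_le_entry c).trans_lt hc

/-- An entry is at least its row index, so the boxes with entry below `k` lie in the first `k` rows.
-/
theorem dominates_content (t : SSYT κ ℕ) : Dominates (parts κ) t.content := by
  refine ⟨by rw [degree_parts, degree_content], fun k => ?_⟩
  rw [sum_range_content, sum_range_parts']
  exact card_le_card (t.filter_subset_filter k)

/-- Equality of all partial sums makes the inclusions behind `dominates_content` equalities, leaving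
only the superstandard tableau. -/
theorem entry_eq_of_content {t : SSYT κ ℕ} (h : t.content = parts κ)
    (c : {c : ℕ × ℕ // c ∈ κ}) : t.entry c = c.1.1 := by
  refine le_antisymm ?_ (t.fst_le_entry c)
  have h1 := eq_of_subset_of_card_le (t.filter_subset_filter (c.1.1 + 1))
    (by rw [← sum_range_parts', ← sum_range_content, h])
  have h2 : c ∈ univ.filter fun c' : {c : ℕ × ℕ // c ∈ κ} => c'.1.1 < c.1.1 + 1 := by simp
  rw [← h1, mem_filter] at h2
  omega

/-- The tableau whose row `i` has all entries `i`. -/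
def superstandard (κ : YoungDiagram) : SSYT κ ℕ where
  entry c := c.1.1
  row_weak _ _ h _ := h.le
  col_strict _ _ _ h := h

theorem content_superstandard (κ : YoungDiagram) : (superstandard κ).content = parts κ := by
  have h : ∀ k, ∑ b ∈ range k, (superstandard κ).content b = ∑ b ∈ range k, parts κ b := fun k => by
    rw [sum_range_content, sum_range_parts']
    rfl
  ext i
  have h1 := h (i + 1)
  rw [sum_range_succ, sum_range_succ, h] at h1
  omega

end SSYT

theorem dominates_of_kostka_ne_zero {β : ℕ →₀ ℕ} (h : kostka κ β ≠ 0) :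
    Dominates (parts κ) β := by
  obtain ⟨t, rfl⟩ := exists_of_kostka_ne_zero h
  exact t.dominates_content

theorem kostka_self (κ : YoungDiagram) : kostka κ (parts κ) = 1 := by
  rw [kostka, Set.ncard_eq_one]
  refine ⟨SSYT.superstandard κ, ?_⟩
  ext t
  simp only [Set.mem_ofPred_eq, Set.mem_singleton_iff]
  constructor
  · intro h
    ext c
    exact SSYT.entry_eq_of_content h c
  · rintro rfl
    exact SSYT.content_superstandard κ

/-- The partitions of `N`. -/
abbrev PartitionOf (N : ℕ) : Type := {κ : YoungDiagram // κ.card = N}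

instance (N : ℕ) : Finite (PartitionOf N) :=
  Finite.of_injective (fun κ => (⟨κ.1, κ.2.le⟩ : Diag N)) fun _ _ h =>
    Subtype.ext (congrArg (fun κ : Diag N => κ.1) h)

noncomputable instance (N : ℕ) : Fintype (PartitionOf N) := Fintype.ofFinite _

/-- Partitions are ordered lexicographically. -/
noncomputable instance (N : ℕ) : LinearOrder (PartitionOf N) :=
  LinearOrder.lift' (fun κ => toLex (parts κ.1)) fun _ _ h =>
    Subtype.ext (parts_injective (toLex_inj.1 h))

/-- The matrix of Kostka numbers. -/
noncomputable def kostkaMatrix (N : ℕ) : Matrix (PartitionOf N) (PartitionOf N) ℤ :=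
  Matrix.of fun κ l => (kostka κ.1 (parts l.1) : ℤ)

/-- Nonzero Kostka numbers respect dominance, hence the lexicographic order, and the diagonal ones
are `1`. Determinant `1` makes the inverse integral. -/
theorem det_kostkaMatrix (N : ℕ) : (kostkaMatrix N).det = 1 := by
  rw [Matrix.det_of_isLowerTriangular]
  · exact prod_eq_one fun κ _ => by rw [kostkaMatrix, Matrix.of_apply, kostka_self, Nat.cast_one]
  · intro κ l h
    rw [kostkaMatrix, Matrix.of_apply, Nat.cast_eq_zero]
    by_contra hc
    exact absurd (dominates_of_kostka_ne_zero hc).toLex_le (not_le.2 h)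

end Kostka

/-! ### Expansions in Schur functions -/

/-- The value of an integral linear combination of Schur functions. -/
noncomputable def schurSum (a : YoungDiagram →₀ ℤ) : MvPowerSeries ℕ ℤ :=
  a.sum fun κ z => z • schur κ

theorem schurSum_apply (a : YoungDiagram →₀ ℤ) (β : ℕ →₀ ℕ) :
    schurSum a β = a.sum fun κ z => z * (kostka κ β : ℤ) := by
  have h : schurSum a β = MvPowerSeries.coeff β (schurSum a) := rfl
  rw [h, schurSum, Finsupp.sum, map_sum]
  exact sum_congr rfl fun κ _ => by rw [map_smul]; rfl

theorem isSymm_schurSum (a : YoungDiagram →₀ ℤ) : IsSymm (schurSum a) := by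
  intro σ β
  rw [schurSum_apply, schurSum_apply]
  refine sum_congr rfl fun κ _ => ?_
  simp only
  rw [← schur_apply, ← schur_apply, isSymm_schur]

theorem schurSum_parts (a : YoungDiagram →₀ ℤ) {N : ℕ} (l : PartitionOf N) :
    schurSum a (parts l.1) = Matrix.vecMul (fun κ : PartitionOf N => a κ.1) (kostkaMatrix N) l := by
  classical
  rw [schurSum_apply, Matrix.vecMul, dotProduct, Finsupp.sum]
  have h1 : ∑ κ : PartitionOf N, a κ.1 * kostkaMatrix N κ l =
      ∑ κ ∈ univ.image (Subtype.val : PartitionOf N → _), a κ * (kostka κ (parts l.1) : ℤ) := by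
    rw [sum_image fun _ _ _ _ h => Subtype.ext h]
    rfl
  rw [h1]
  refine sum_congr_of_eq_on_inter ?_ ?_ fun _ _ _ => rfl
  · intro κ _ hκ
    rw [mul_eq_zero, Nat.cast_eq_zero]
    right
    by_contra hc
    refine hκ (mem_image.2 ⟨⟨κ, ?_⟩, mem_univ _, rfl⟩)
    rw [← degree_of_kostka_ne_zero hc, degree_parts, l.2]
  · intro κ _ hκ
    rw [Finsupp.notMem_support_iff.1 hκ, zero_mul]

/-- The coefficients of the monomials indexed by partitions of a fixed size are obtained from the
Schur coefficients of that size by an invertible Kostka matrix. -/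
theorem schurSum_injective : Function.Injective schurSum := by
  intro a b h
  ext κ
  have h1 : Matrix.vecMul (fun ρ : PartitionOf κ.card => a ρ.1) (kostkaMatrix κ.card) =
      Matrix.vecMul (fun ρ : PartitionOf κ.card => b ρ.1) (kostkaMatrix κ.card) := by
    funext l
    rw [← schurSum_parts, ← schurSum_parts, h]
  have h2 := congrArg (fun v => Matrix.vecMul v (kostkaMatrix κ.card)⁻¹) h1
  simp only [Matrix.vecMul_vecMul] at h2
  rw [Matrix.mul_nonsing_inv _ (by rw [det_kostkaMatrix]; exact isUnit_one), Matrix.vecMul_one,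
    Matrix.vecMul_one] at h2
  exact congrFun h2 ⟨κ, rfl⟩

/-- A symmetric function, homogeneous of degree `N`, is a linear combination of Schur functions. -/
theorem exists_schurSum_eq {F : MvPowerSeries ℕ ℤ} (hF : IsSymm F) {N : ℕ}
    (hN : ∀ β, F β ≠ 0 → β.degree = N) :
    ∃ a, schurSum a = F ∧ ∀ κ, a κ ≠ 0 → κ.card = N := by
  classical
  set v : PartitionOf N → ℤ :=
    Matrix.vecMul (fun l => F (parts l.1)) (kostkaMatrix N)⁻¹ with hv
  set a : YoungDiagram →₀ ℤ := Finsupp.onFinset (univ.image (Subtype.val : PartitionOf N → _))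
    (fun κ => if h : κ.card = N then v ⟨κ, h⟩ else 0) (fun κ h => by
      by_cases hc : κ.card = N
      · exact mem_image.2 ⟨⟨κ, hc⟩, mem_univ _, rfl⟩
      · exact absurd (dif_neg hc) h) with ha
  have ha' : ∀ κ, a κ ≠ 0 → κ.card = N := by
    intro κ h
    by_contra hc
    exact h (dif_neg hc)
  refine ⟨a, ?_, ha'⟩
  funext β
  -- Both sides are symmetric, so agreement on partition exponents suffices, and there `a` was
  -- defined by inverting the Kostka matrix.
  obtain ⟨l, -, hl⟩ := exists_sorted β
  rw [← hl _ hF, ← hl _ (isSymm_schurSum a)]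
  by_cases hlN : l.card = N
  · have h1 := schurSum_parts a ⟨l, hlN⟩
    refine h1.trans ?_
    have h2 : (fun κ : PartitionOf N => a κ.1) = v := by
      funext κ
      exact dif_pos κ.2
    rw [h2, hv, Matrix.vecMul_vecMul, Matrix.nonsing_inv_mul _
      (by convert isUnit_one; convert det_kostkaMatrix N), Matrix.vecMul_one]
  · have h1 : F (parts l) = 0 := by
      by_contra hc
      exact hlN (by rw [← hN _ hc, degree_parts])
    rw [h1, schurSum_apply]
    refine sum_eq_zero fun κ hκ => ?_
    simp only
    rw [mul_eq_zero, Nat.cast_eq_zero]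
    right
    by_contra hc
    have h2 := degree_of_kostka_ne_zero hc
    rw [degree_parts, ha' κ (Finsupp.mem_support_iff.1 hκ)] at h2
    exact hlN h2

/-- Uniqueness of Schur expansions ensures that the default value `0` in `schurCoeff` is not used
here. -/
theorem schurCoeff_schurSum (a : YoungDiagram →₀ ℤ) : schurCoeff (schurSum a) = a := by
  have h : ∃! b : YoungDiagram →₀ ℤ, schurSum a = b.sum fun κ z => z • schur κ :=
    ⟨a, rfl, fun b hb => (schurSum_injective hb).symm⟩
  rw [schurCoeff, dif_pos h]
  exact (schurSum_injective h.choose_spec.1).symm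

theorem schurCoeff_schur (κ : YoungDiagram) : schurCoeff (schur κ) = Finsupp.single κ 1 := by
  have h : schur κ = schurSum (Finsupp.single κ 1) := by
    rw [schurSum, Finsupp.sum_single_index (h := fun ρ z => z • schur ρ) (zero_smul _ _), one_smul]
  rw [h, schurCoeff_schurSum]

theorem hallInner_schurSum (a : YoungDiagram →₀ ℤ) (κ : YoungDiagram) :
    hallInner (schurSum a) (schur κ) = a κ := by
  classical
  rw [hallInner, schurCoeff_schurSum, schurCoeff_schur, Finsupp.sum_eq_single κ]
  · simp
  · intro ρ _ hρ
    rw [Finsupp.single_eq_of_ne hρ, mul_zero]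
  · simp

/-! ### The coefficients of a plethysm -/

section Plethysm

variable {μ ν : YoungDiagram}

namespace PSSYT

/-- The weight depends only on how often each `μ`-tableau occurs, which is what connects weights
with the substitution defining the plethysm. -/
theorem wt_eq_sum_content (T : PSSYT μ ν) :
    T.wt = (SSYT.content T).sum fun t k => k • t.content := by
  have h : T.wt = ∑ c : {c : ℕ × ℕ // c ∈ ν}, (T.entry c).content := rfl
  rw [h, SSYT.content, ← Finsupp.sum_finsetSum_index (h := fun (t : SSYT μ ℕ) k => k • t.content)
    (fun _ => zero_smul _ _) fun _ _ _ => add_smul _ _ _]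
  refine sum_congr rfl fun c _ => ?_
  rw [Finsupp.sum_single_index (h := fun (t : SSYT μ ℕ) k => k • t.content) (zero_smul _ _),
    one_smul]

theorem degree_wt (T : PSSYT μ ν) : T.wt.degree = μ.card * ν.card := by
  have h : T.wt = ∑ c : {c : ℕ × ℕ // c ∈ ν}, (T.entry c).content := rfl
  rw [h, map_sum, sum_congr rfl fun c _ => SSYT.degree_content (T.entry c), sum_const, smul_eq_mul,
    mul_comm, card_univ]
  congr 1
  exact Fintype.card_of_subtype ν.cells fun c => ν.mem_cells c

theorem finite_wt_eq (β : ℕ →₀ ℕ) : {T : PSSYT μ ν | T.wt = β}.Finite := by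
  have hfin := SSYT.finite_content_le (κ := μ) β
  have : Finite ↥{t : SSYT μ ℕ | t.content ≤ β} := hfin
  let f : ↥{T : PSSYT μ ν | T.wt = β} →
      ({c : ℕ × ℕ // c ∈ ν} → ↥{t : SSYT μ ℕ | t.content ≤ β}) :=
    fun T c => ⟨T.1.entry c, by
      have h : PSSYT.wt T.1 = ∑ c : {c : ℕ × ℕ // c ∈ ν}, (T.1.entry c).content := rfl
      have h1 : PSSYT.wt T.1 = β := T.2
      refine le_trans ?_ (h.symm.trans h1).le
      exact single_le_sum (f := fun c => (T.1.entry c).content) (fun _ _ => zero_le) (mem_univ c)⟩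
  have : Finite ↥{T : PSSYT μ ν | T.wt = β} := by
    refine Finite.of_injective f fun T U h => Subtype.ext (SSYT.ext (funext fun c => ?_))
    exact congrArg Subtype.val (congrFun h c)
  exact Set.toFinite _

end PSSYT

theorem numPSSYT_ne_zero_iff {β : ℕ →₀ ℕ} : numPSSYT μ ν β ≠ 0 ↔ ∃ T : PSSYT μ ν, T.wt = β := by
  rw [numPSSYT, Ne, Set.ncard_eq_zero (PSSYT.finite_wt_eq β), ← Ne, ← Set.nonempty_iff_ne_empty]
  rfl

/-- The numbering need not preserve the order of `I`. Both counts equal the same product of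
commuting strip operators, so the alphabet's order is irrelevant. -/
theorem ncard_content_eq_kostka {I : Type*} [LinearOrder I] [Countable I] (α : I →₀ ℕ) :
    {t : SSYT ν I | t.content = α}.ncard = kostka ν (α.embDomain (numbering I)) := by
  have h1 := ncard_content_eq (M := ν.card) ⟨ν, le_rfl⟩ α
  have h2 := ncard_content_eq (M := ν.card) ⟨ν, le_rfl⟩ (α.embDomain (numbering I))
  rw [Finsupp.prod_embDomain] at h2
  exact_mod_cast h1.trans h2.symm

theorem plethysm_apply_eq_finsum (β : ℕ →₀ ℕ) : plethysm (schur ν) μ β =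
    ∑ᶠ (α : SSYT μ ℕ →₀ ℕ) (_ : (α.sum fun t k => k • t.content) = β),
      ({T : PSSYT μ ν | SSYT.content T = α}.ncard : ℤ) := by
  refine finsum_congr fun α => finsum_congr fun _ => ?_
  rw [ncard_content_eq_kostka]
  rfl

/-- Plethystic tableaux of weight `β` are grouped by their content as `ν`-tableaux, each content
accounting for one term of the substitution. -/
theorem plethysm_apply (β : ℕ →₀ ℕ) : plethysm (schur ν) μ β = (numPSSYT μ ν β : ℤ) := by
  classical
  rw [plethysm_apply_eq_finsum]
  have hfin := PSSYT.finite_wt_eq (μ := μ) (ν := ν) β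
  rw [finsum_eq_sum_of_support_subset (s := hfin.toFinset.image SSYT.content), numPSSYT,
    Set.ncard_eq_toFinset_card _ hfin, card_eq_sum_card_image SSYT.content, Nat.cast_sum]
  · refine sum_congr rfl fun α hα => ?_
    obtain ⟨T, hT, rfl⟩ := mem_image.1 hα
    have hT' : PSSYT.wt T = β := hfin.mem_toFinset.1 hT
    rw [PSSYT.wt_eq_sum_content] at hT'
    rw [finsum_eq_if, if_pos hT', ← Set.ncard_coe_finset]
    congr 2
    ext U
    simp only [Set.mem_ofPred_eq, coe_filter, Set.Finite.mem_toFinset]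
    constructor
    · intro h
      exact ⟨by rw [PSSYT.wt_eq_sum_content, h, hT'], h⟩
    · exact fun h => h.2
  · intro α hα
    rw [Function.mem_support, finsum_eq_if] at hα
    by_cases h : (α.sum fun t k => k • t.content) = β
    · rw [if_pos h, Nat.cast_ne_zero] at hα
      obtain ⟨T, hT⟩ := Set.nonempty_of_ncard_ne_zero hα
      rw [coe_image]
      refine ⟨T, ?_, hT⟩
      rw [mem_coe, Set.Finite.mem_toFinset, Set.mem_ofPred_eq, PSSYT.wt_eq_sum_content,
        show SSYT.content T = α from hT, h]
    · rw [if_neg h] at hα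
      exact absurd rfl hα

/-- By symmetry of `s_μ`, contents `γ` and `σγ` are realised by equally many tableaux, finitely many
in each case; arbitrary bijections between these fibres glue together. -/
theorem exists_equiv_content (μ : YoungDiagram) (σ : Equiv.Perm ℕ) :
    ∃ e : SSYT μ ℕ ≃ SSYT μ ℕ, ∀ t, (e t).content = Finsupp.equivMapDomain σ t.content := by
  have h : ∀ β : ℕ →₀ ℕ, Nonempty ({t : SSYT μ ℕ // Finsupp.equivMapDomain σ t.content = β} ≃
      {t : SSYT μ ℕ // t.content = β}) := by
    intro β
    obtain ⟨γ, rfl⟩ := (Finsupp.equivCongrLeft (M := ℕ) σ).surjective β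
    have hs : {t : SSYT μ ℕ | Finsupp.equivMapDomain σ t.content =
        Finsupp.equivCongrLeft σ γ} = {t : SSYT μ ℕ | t.content = γ} := by
      ext t
      exact (Finsupp.equivCongrLeft (M := ℕ) σ).injective.eq_iff
    have f1 : Finite {t : SSYT μ ℕ // t.content = γ} := SSYT.finite_content_eq γ
    have f2 : Finite {t : SSYT μ ℕ // t.content = Finsupp.equivCongrLeft σ γ} :=
      SSYT.finite_content_eq _
    have f3 : Finite {t : SSYT μ ℕ // Finsupp.equivMapDomain σ t.content =
        Finsupp.equivCongrLeft σ γ} := by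
      have := SSYT.finite_content_eq (κ := μ) γ
      rw [← hs] at this
      exact this
    refine (Finite.card_eq (α := {t : SSYT μ ℕ // _})).1 ?_
    have h1 : kostka μ (Finsupp.equivMapDomain σ γ) = kostka μ γ := by
      exact Nat.cast_injective (R := ℤ) (isSymm_schur μ σ γ)
    have h2 := congrArg Set.ncard hs
    exact h2.trans h1.symm
  exact ⟨Equiv.ofFiberEquiv fun β => (h β).some, fun t => Equiv.ofFiberEquiv_map _ t⟩

/-- A permutation of the letters is realised by a permutation `e` of the `μ`-tableaux, and permuting
these variables does not change `s_ν`. -/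
theorem isSymm_plethysm (μ ν : YoungDiagram) : IsSymm (plethysm (schur ν) μ) := by
  intro σ β
  obtain ⟨e, he⟩ := exists_equiv_content μ σ
  rw [plethysm_apply_eq_finsum, plethysm_apply_eq_finsum,
    ← finsum_comp_equiv (Finsupp.equivCongrLeft (M := ℕ) e)]
  refine finsum_congr fun α => ?_
  simp only [Finsupp.equivCongrLeft_apply]
  have h1 : ((Finsupp.equivMapDomain e α).sum fun t k => k • t.content) =
      Finsupp.equivMapDomain σ (α.sum fun t k => k • t.content) := by
    rw [Finsupp.sum_equivMapDomain, Finsupp.equivMapDomain_eq_mapDomain, Finsupp.sum, Finsupp.sum,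
      Finsupp.mapDomain_finsetSum]
    refine sum_congr rfl fun t _ => ?_
    rw [he, Finsupp.equivMapDomain_eq_mapDomain, Finsupp.mapDomain_smul]
  have h2 : {T : PSSYT μ ν | SSYT.content T = Finsupp.equivMapDomain e α}.ncard =
      {T : PSSYT μ ν | SSYT.content T = α}.ncard := by
    have h3 := ncard_content_eq (M := ν.card) ⟨ν, le_rfl⟩ α
    have h4 := ncard_content_eq (M := ν.card) ⟨ν, le_rfl⟩ (Finsupp.equivMapDomain e α)
    rw [Finsupp.prod_equivMapDomain] at h4
    exact_mod_cast h4.trans h3.symm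
  rw [h1, h2]
  exact finsum_congr_Prop (propext (Finsupp.equivCongrLeft (M := ℕ) σ).injective.eq_iff)
    fun _ => rfl

theorem exists_schurSum_eq_plethysm (μ ν : YoungDiagram) :
    ∃ a, schurSum a = plethysm (schur ν) μ ∧ ∀ κ, a κ ≠ 0 → κ.card = μ.card * ν.card := by
  refine exists_schurSum_eq (isSymm_plethysm μ ν) fun β hβ => ?_
  rw [plethysm_apply, Nat.cast_ne_zero, numPSSYT_ne_zero_iff] at hβ
  obtain ⟨T, rfl⟩ := hβ
  exact T.degree_wt

end Plethysm

/-! ### Maximal constituents -/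

section Maximal

variable {a : YoungDiagram →₀ ℤ}

theorem exists_dominates_of_schurSum_ne_zero {β : ℕ →₀ ℕ} (h : schurSum a β ≠ 0) :
    ∃ κ, a κ ≠ 0 ∧ Dominates (parts κ) β := by
  rw [schurSum_apply] at h
  obtain ⟨κ, h1, h2⟩ := exists_ne_zero_of_sum_ne_zero h
  simp only [ne_eq, mul_eq_zero, Nat.cast_eq_zero, not_or] at h2
  exact ⟨κ, h2.1, dominates_of_kostka_ne_zero h2.2⟩

/-- Any `ρ` contributing to the monomial with exponent `κ` dominates `κ`, so by maximality only `κ`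
contributes, with Kostka number `1`. -/
theorem schurSum_parts_of_maximal {κ : YoungDiagram}
    (h : ∀ ρ, a ρ ≠ 0 → Dominates (parts ρ) (parts κ) → ρ = κ) :
    schurSum a (parts κ) = a κ := by
  rw [schurSum_apply, Finsupp.sum_eq_single κ]
  · rw [kostka_self, Nat.cast_one, mul_one]
  · intro ρ h1 h2
    rw [mul_eq_zero, Nat.cast_eq_zero]
    right
    by_contra hc
    exact h2 (h ρ h1 (dominates_of_kostka_ne_zero hc))
  · intro _
    rw [zero_mul]

/-- The support is finite, and a lexicographically greatest element among those dominating `κ` is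
dominance-maximal. -/
theorem exists_maximal_dominates {κ : YoungDiagram} (h : a κ ≠ 0) :
    ∃ ρ, a ρ ≠ 0 ∧ Dominates (parts ρ) (parts κ) ∧
      ∀ ρ', a ρ' ≠ 0 → Dominates (parts ρ') (parts ρ) → ρ' = ρ := by
  classical
  have hne : (a.support.filter fun ρ => Dominates (parts ρ) (parts κ)).Nonempty :=
    ⟨κ, mem_filter.2 ⟨Finsupp.mem_support_iff.2 h, Dominates.refl _⟩⟩
  obtain ⟨ρ, h1, h2⟩ := exists_max_image _ (fun ρ => toLex (parts ρ)) hne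
  obtain ⟨h3, h4⟩ := mem_filter.1 h1
  refine ⟨ρ, Finsupp.mem_support_iff.1 h3, h4, fun ρ' h5 h6 => ?_⟩
  have h7 := h2 ρ' (mem_filter.2 ⟨Finsupp.mem_support_iff.2 h5, h6.trans h4⟩)
  exact parts_injective (toLex_inj.1 (le_antisymm h7 h6.toLex_le))

theorem one_le_of_maximal (hpos : ∀ β, 0 ≤ schurSum a β) {κ : YoungDiagram} (hκ : a κ ≠ 0)
    (h : ∀ ρ, a ρ ≠ 0 → Dominates (parts ρ) (parts κ) → ρ = κ) : 1 ≤ a κ := by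
  have h1 := hpos (parts κ)
  rw [schurSum_parts_of_maximal h] at h1
  omega

/-- Negative coefficients are not excluded a priori, but each `ρ'` with `a ρ' ≠ 0` lies below a
maximal one, whose coefficient is positive. Hence `1 ≤ a κ` and `a κ ≠ 0` have the same maximal
elements. -/
theorem mem_maximalPartitions_iff (hpos : ∀ β, 0 ≤ schurSum a β) {κ : YoungDiagram} :
    κ ∈ maximalPartitions {κ | 1 ≤ a κ} ↔
      a κ ≠ 0 ∧ ∀ ρ, a ρ ≠ 0 → Dominates (parts ρ) (parts κ) → ρ = κ := by
  constructor
  · rintro ⟨h1, h2⟩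
    have h1 : 1 ≤ a κ := h1
    have h3 : a κ ≠ 0 := by omega
    refine ⟨h3, fun ρ' h4 h5 => ?_⟩
    obtain ⟨ρ, h6, h7, h8⟩ := exists_maximal_dominates h4
    have h9 := h2 ρ (one_le_of_maximal hpos h6 h8) (h7.trans h5)
    subst h9
    exact parts_injective (h5.antisymm h7)
  · rintro ⟨h1, h2⟩
    refine ⟨one_le_of_maximal hpos h1 h2, fun ρ hρ => h2 ρ ?_⟩
    have hρ : 1 ≤ a ρ := hρ
    omega

/-- The maximal partitions in an expansion in Schur functions with nonnegative coefficients of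
monomials are the maximal exponents. -/
theorem parts_image_maximalPartitions (hpos : ∀ β, 0 ≤ schurSum a β) :
    parts '' maximalPartitions {κ | 1 ≤ a κ} =
      {β | schurSum a β ≠ 0 ∧ ∀ γ, schurSum a γ ≠ 0 → Dominates γ β → γ = β} := by
  ext β
  constructor
  · rintro ⟨κ, hκ, rfl⟩
    obtain ⟨h1, h2⟩ := (mem_maximalPartitions_iff hpos).1 hκ
    refine ⟨by rwa [schurSum_parts_of_maximal h2], fun γ h3 h4 => ?_⟩
    obtain ⟨ρ, h5, h6⟩ := exists_dominates_of_schurSum_ne_zero h3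
    have h7 := h2 ρ h5 (h6.trans h4)
    subst h7
    exact h4.antisymm h6
  · rintro ⟨h1, h2⟩
    obtain ⟨κ, h3, h4⟩ := exists_dominates_of_schurSum_ne_zero h1
    obtain ⟨ρ, h5, h6, h7⟩ := exists_maximal_dominates h3
    refine ⟨ρ, (mem_maximalPartitions_iff hpos).2 ⟨h5, h7⟩, h2 _ ?_ (h6.trans h4)⟩
    rwa [schurSum_parts_of_maximal h7]

end Maximal

theorem constituents_schurSum (a : YoungDiagram →₀ ℤ) :
    constituents (schurSum a) = {κ | 1 ≤ a κ} := by
  ext κ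
  simp only [constituents, hallInner_schurSum, Set.mem_ofPred_eq]

theorem maximalWeights_eq (μ ν : YoungDiagram) : maximalWeights μ ν =
    {β | plethysm (schur ν) μ β ≠ 0 ∧
      ∀ γ, plethysm (schur ν) μ γ ≠ 0 → Dominates γ β → γ = β} := by
  ext β
  simp only [maximalWeights, plethysm_apply, Nat.cast_ne_zero, numPSSYT_ne_zero_iff,
    Set.mem_ofPred_eq, forall_exists_index, forall_apply_eq_imp_iff]

theorem schurSum_nonneg_of_eq {μ ν : YoungDiagram} {a : YoungDiagram →₀ ℤ}
    (ha : schurSum a = plethysm (schur ν) μ) (β : ℕ →₀ ℕ) : 0 ≤ schurSum a β := by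
  rw [ha, plethysm_apply]
  exact Nat.cast_nonneg _

/-- The maximal constituents of a plethysm. -/
theorem parts_image_maximal_constituents (μ ν : YoungDiagram) :
    parts '' maximalPartitions (constituents (plethysm (schur ν) μ)) = maximalWeights μ ν := by
  obtain ⟨a, ha, -⟩ := exists_schurSum_eq_plethysm μ ν
  rw [maximalWeights_eq, ← ha, constituents_schurSum,
    parts_image_maximalPartitions (schurSum_nonneg_of_eq ha)]

/-- The multiplicities of the maximal constituents of a plethysm. -/
theorem hallInner_of_maximal {μ ν κ : YoungDiagram}
    (h : κ ∈ maximalPartitions (constituents (plethysm (schur ν) μ))) :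
    hallInner (plethysm (schur ν) μ) (schur κ) = (numPSSYT μ ν (parts κ) : ℤ) := by
  obtain ⟨a, ha, -⟩ := exists_schurSum_eq_plethysm μ ν
  rw [← plethysm_apply]
  rw [← ha] at h ⊢
  rw [constituents_schurSum, mem_maximalPartitions_iff (schurSum_nonneg_of_eq ha)] at h
  rw [hallInner_schurSum, schurSum_parts_of_maximal h.2]

/-! ### Transposition and dominance -/

theorem sum_range_parts_transpose (κ : YoungDiagram) (k : ℕ) :
    ∑ j ∈ range k, parts κ.transpose j = (κ.cells.filter fun c => c.2 < k).card := by
  rw [sum_range_parts]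
  refine card_bij' (fun c _ => c.swap) (fun c _ => c.swap) ?_ ?_ (fun _ _ => rfl) fun _ _ => rfl
  · intro c hc
    simpa using hc
  · intro c hc
    simpa using hc

theorem card_filter_le_snd (κ : YoungDiagram) (l n : ℕ) :
    (κ.cells.filter fun c => c.1 < n ∧ l ≤ c.2).card = ∑ i ∈ range n, (κ.rowLen i - l) := by
  rw [card_eq_sum_card_fiberwise (f := Prod.fst) (t := range n)
    (fun c hc => by simpa using (mem_filter.1 hc).2.1)]
  refine sum_congr rfl fun i hi => ?_
  have h : (((κ.cells.filter fun c => c.1 < n ∧ l ≤ c.2)).filter fun c => c.1 = i) =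
      {i} ×ˢ Ico l (κ.rowLen i) := by
    ext ⟨i', j⟩
    simp only [mem_filter, YoungDiagram.mem_cells, YoungDiagram.mem_iff_lt_rowLen, mem_product,
      mem_singleton, mem_Ico, mem_range] at hi ⊢
    constructor
    · rintro ⟨⟨h1, h2, h3⟩, rfl⟩
      exact ⟨rfl, h3, h1⟩
    · rintro ⟨rfl, h3, h1⟩
      exact ⟨⟨h1, hi, h3⟩, rfl⟩
  rw [h, card_product, card_singleton, one_mul, Nat.card_Ico]

theorem Dominates.transpose {κ l : YoungDiagram} (h : Dominates (parts κ) (parts l)) :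
    Dominates (parts l.transpose) (parts κ.transpose) := by
  have hcard : κ.card = l.card := by rw [← degree_parts, ← degree_parts, h.1]
  refine ⟨by rw [degree_parts, degree_parts, card_transpose, card_transpose, hcard], fun k => ?_⟩
  rw [sum_range_parts_transpose, sum_range_parts_transpose]
  have hsplit : ∀ ρ : YoungDiagram, (ρ.cells.filter fun c => c.2 < k).card +
      (ρ.cells.filter fun c => k ≤ c.2).card = ρ.card := fun ρ => by
    rw [YoungDiagram.card, ← card_filter_add_card_filter_not (s := ρ.cells) fun c => c.2 < k]
    simp only [not_lt]
  have e1 := hsplit κ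
  have e2 := hsplit l
  suffices (l.cells.filter fun c => k ≤ c.2).card ≤ (κ.cells.filter fun c => k ≤ c.2).card by
    omega
  -- With this choice the first `n` rows of `l` are exactly those longer than `k`, so the truncated
  -- differences `l.rowLen i - k` are exact. For `κ` truncation can only enlarge the sum, which is
  -- the direction needed.
  set n := l.colLen k with hn
  have h1 : (l.cells.filter fun c => k ≤ c.2) =
      l.cells.filter fun c => c.1 < n ∧ k ≤ c.2 := by
    refine filter_congr fun c hc => ⟨fun h => ⟨?_, h⟩, fun h => h.2⟩
    exact YoungDiagram.mem_iff_lt_colLen.1 (l.up_left_mem le_rfl h ((l.mem_cells _).1 hc))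
  have h2 : (κ.cells.filter fun c => c.1 < n ∧ k ≤ c.2).card ≤
      (κ.cells.filter fun c => k ≤ c.2).card :=
    card_le_card (monotone_filter_right _ fun _ _ h => h.2)
  refine le_trans ?_ h2
  rw [h1, card_filter_le_snd, card_filter_le_snd]
  have h3 : ∑ i ∈ range n, (l.rowLen i - k) + n * k = ∑ i ∈ range n, parts l i := by
    rw [← smul_eq_mul, ← card_range n, ← sum_const, card_range, ← sum_add_distrib]
    refine sum_congr rfl fun i hi => Nat.sub_add_cancel ?_
    exact (YoungDiagram.mem_iff_lt_rowLen.1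
      (YoungDiagram.mem_iff_lt_colLen.2 (mem_range.1 hi))).le
  have h4 : ∑ i ∈ range n, parts κ i ≤ ∑ i ∈ range n, (κ.rowLen i - k) + n * k := by
    rw [← smul_eq_mul, ← card_range n, ← sum_const, card_range, ← sum_add_distrib]
    exact sum_le_sum fun i _ => by rw [parts_apply]; exact Nat.le_add_of_sub_le le_rfl
  have h5 := h.2 n
  omega

theorem dominates_transpose_iff {κ l : YoungDiagram} :
    Dominates (parts l.transpose) (parts κ.transpose) ↔ Dominates (parts κ) (parts l) := by
  refine ⟨fun h => ?_, Dominates.transpose⟩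
  have := h.transpose
  rwa [YoungDiagram.transpose_transpose, YoungDiagram.transpose_transpose] at this

/-! ### Supersymmetry -/

/-- The coefficients `D β γ` of `x^β y^γ` in a formal power series in two sets of variables which,
for `i, j < k`, does not depend on `x_i` after the substitution `y_j = -x_i`. -/
def IsSuper (k : ℕ) (D : (ℕ →₀ ℕ) → (ℕ →₀ ℕ) → ℤ) : Prop :=
  ∀ i < k, ∀ j < k, ∀ β γ : ℕ →₀ ℕ, β i = 0 → γ j = 0 → ∀ d, d ≠ 0 →
    ∑ p ∈ antidiagonal d,
      (-1) ^ p.2 * D (β + Finsupp.single i p.1) (γ + Finsupp.single j p.2) = 0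

/-- A supersymmetric series is determined by its part without variables `y`. -/
theorem IsSuper.eq_zero {k : ℕ} {D : (ℕ →₀ ℕ) → (ℕ →₀ ℕ) → ℤ} (hD : IsSuper k D)
    (h0 : ∀ β : ℕ →₀ ℕ, β.support ⊆ range k → D β 0 = 0) (β γ : ℕ →₀ ℕ)
    (hβ : β.support ⊆ range k) (hγ : γ.support ⊆ range k)
    (hfresh : γ.degree ≤ ((range k).filter fun i => β i = 0).card) : D β γ = 0 := by
  classical
  obtain ⟨n, hn⟩ : ∃ n, n = γ.degree := ⟨_, rfl⟩
  induction n using Nat.strong_induction_on generalizing β γ with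
  | _ n ih =>
    by_cases hz : γ = 0
    · rw [hz]; exact h0 β hβ
    obtain ⟨j, hj⟩ := Finsupp.ne_iff.1 hz
    rw [Finsupp.zero_apply] at hj
    have hjk : j < k := mem_range.1 (hγ (Finsupp.mem_support_iff.2 hj))
    have hsplit : γ.erase j + Finsupp.single j (γ j) = γ := Finsupp.erase_add_single j γ
    have hdeg := congrArg Finsupp.degree hsplit
    rw [map_add, Finsupp.degree_single] at hdeg
    -- A fresh variable `x_i`, absent from `β`, exists because there are at least `γ.degree > 0` of
    -- them. Each step uses one up and lowers the degree in `y` by at least one, so the bound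
    -- persists.
    obtain ⟨i, hi⟩ : ((range k).filter fun i => β i = 0).Nonempty := by
      rw [← card_pos]
      omega
    obtain ⟨hik, hi0⟩ := mem_filter.1 hi
    -- In this relation the term with exponent `0` for `x_i` is `D β γ` up to sign; every other term
    -- has smaller degree in `y`.
    have hrel := hD i (mem_range.1 hik) j hjk β (γ.erase j) hi0 Finsupp.erase_same (γ j) hj
    have hmem : ((0, γ j) : ℕ × ℕ) ∈ antidiagonal (γ j) :=
      HasAntidiagonal.mem_antidiagonal.2 (zero_add _)
    rw [← add_sum_erase _ _ hmem, sum_eq_zero, add_zero, Finsupp.single_zero, add_zero, hsplit]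
      at hrel
    · exact (mul_eq_zero.1 hrel).resolve_left (pow_ne_zero _ (by norm_num))
    · intro p hp
      obtain ⟨hne, hp⟩ := mem_erase.1 hp
      have hp := HasAntidiagonal.mem_antidiagonal.1 hp
      have hlt : p.2 < γ j := by
        by_contra hc
        exact hne (Prod.ext (by simp only; omega) (by simp only; omega))
      have hd : (γ.erase j + Finsupp.single j p.2).degree = (γ.erase j).degree + p.2 := by
        rw [map_add, Finsupp.degree_single]
      rw [mul_eq_zero]
      right
      refine ih _ ?_ _ _ ?_ ?_ ?_ rfl
      · omega
      · refine Finsupp.support_add.trans (union_subset hβ ?_)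
        exact Finsupp.support_single_subset.trans (singleton_subset_iff.2 hik)
      · refine Finsupp.support_add.trans (union_subset ?_ ?_)
        · rw [Finsupp.support_erase]
          exact (erase_subset _ _).trans hγ
        · exact Finsupp.support_single_subset.trans (singleton_subset_iff.2 (mem_range.2 hjk))
      · have hsub : ((range k).filter fun i => β i = 0).erase i ⊆
            (range k).filter fun i' => (β + Finsupp.single i p.1) i' = 0 := by
          intro i' hi'
          obtain ⟨h1, h2⟩ := mem_erase.1 hi'
          obtain ⟨h3, h4⟩ := mem_filter.1 h2
          refine mem_filter.2 ⟨h3, ?_⟩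
          rw [Finsupp.add_apply, h4, Finsupp.single_eq_of_ne h1, add_zero]
        have hcard := card_le_card hsub
        rw [card_erase_of_mem hi] at hcard
        omega

/-- The operator adding horizontal strips of sizes `δ (inl i)` and vertical strips of sizes
`δ (inr j)`. -/
noncomputable def superProd (M : ℕ) (δ : ℕ ⊕ ℕ →₀ ℕ) : StripRing M :=
  δ.prod fun v a => strip M v.isRight a

/-- The number of supertableaux of shape `κ` and content `δ`. -/
noncomputable def superKostka {M : ℕ} (κ : Diag M) (δ : ℕ ⊕ ℕ →₀ ℕ) : ℤ :=
  StripRing.val M (superProd M δ) κ (Diag.empty M)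

theorem superProd_add {M : ℕ} {δ : ℕ ⊕ ℕ →₀ ℕ} {i j : ℕ} (hi : δ (Sum.inl i) = 0)
    (hj : δ (Sum.inr j) = 0) (a b : ℕ) :
    superProd M (δ + Finsupp.single (Sum.inl i) a + Finsupp.single (Sum.inr j) b) =
      superProd M δ * (strip M false a * strip M true b) := by
  classical
  have h1 : Disjoint δ.support (Finsupp.single (Sum.inl i : ℕ ⊕ ℕ) a).support := by
    refine disjoint_of_subset_right Finsupp.support_single_subset ?_
    rw [disjoint_singleton_right, Finsupp.mem_support_iff]
    exact fun h => h hi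
  have h2 : Disjoint (δ + Finsupp.single (Sum.inl i : ℕ ⊕ ℕ) a).support
      (Finsupp.single (Sum.inr j : ℕ ⊕ ℕ) b).support := by
    refine disjoint_of_subset_right Finsupp.support_single_subset ?_
    rw [disjoint_singleton_right, Finsupp.mem_support_iff, Finsupp.add_apply, hj,
      Finsupp.single_eq_of_ne (by simp)]
    exact fun h => h rfl
  rw [superProd, Finsupp.prod_add_index_of_disjoint h2, Finsupp.prod_add_index_of_disjoint h1,
    Finsupp.prod_single_index (h := fun (v : ℕ ⊕ ℕ) a => strip M v.isRight a) (strip_zero _ _),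
    Finsupp.prod_single_index (h := fun (v : ℕ ⊕ ℕ) a => strip M v.isRight a) (strip_zero _ _),
    mul_assoc]
  rfl

/-- The relation between horizontal and vertical strips, multiplied by the operators of the
remaining letters. -/
theorem superKostka_rel {M : ℕ} (κ : Diag M) {δ : ℕ ⊕ ℕ →₀ ℕ} {i j : ℕ}
    (hi : δ (Sum.inl i) = 0) (hj : δ (Sum.inr j) = 0) {d : ℕ} (hd : d ≠ 0) :
    ∑ p ∈ antidiagonal d, (-1) ^ p.2 * superKostka κ
      (δ + Finsupp.single (Sum.inl i) p.1 + Finsupp.single (Sum.inr j) p.2) = 0 := by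
  have h := congrArg (fun x => StripRing.val M (superProd M δ * x) κ (Diag.empty M))
    (sum_strip_mul_strip M hd)
  simp only [mul_zero, map_zero, Matrix.zero_apply, mul_sum, map_sum, Matrix.sum_apply] at h
  rw [← h]
  refine sum_congr rfl fun p _ => ?_
  rw [superKostka, superProd_add hi hj, mul_left_comm (superProd M δ) ((-1) ^ p.2),
    map_mul (StripRing.val M) ((-1) ^ p.2), map_pow, map_neg, map_one]
  rcases Nat.even_or_odd p.2 with h | h <;> simp [h.neg_one_pow]

theorem hMat_nonneg (M a : ℕ) (κ l : Diag M) : 0 ≤ hMat M a κ l := by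
  rw [hMat, Matrix.of_apply]
  split_ifs <;> norm_num

/-- This licenses `toNat` when these numbers become exponents in the super plethysm. -/
theorem superKostka_nonneg {M : ℕ} (κ : Diag M) (δ : ℕ ⊕ ℕ →₀ ℕ) : 0 ≤ superKostka κ δ := by
  have h : ∀ κ l : Diag M, 0 ≤ StripRing.val M (superProd M δ) κ l := by
    rw [superProd, Finsupp.prod]
    refine prod_induction _ (fun x => ∀ κ l : Diag M, 0 ≤ StripRing.val M x κ l) ?_ ?_ ?_
    · intro x y hx hy κ l
      rw [map_mul, Matrix.mul_apply]
      exact sum_nonneg fun ρ _ => mul_nonneg (hx _ _) (hy _ _)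
    · intro κ l
      rw [map_one, Matrix.one_apply]
      split_ifs <;> norm_num
    · intro v _ κ l
      cases v with
      | inl i => exact hMat_nonneg M _ κ l
      | inr j =>
        have h1 : StripRing.val M (strip M (Sum.inr j : ℕ ⊕ ℕ).isRight (δ (Sum.inr j))) =
          eMat M (δ (Sum.inr j)) := rfl
        rw [h1, eMat_eq]
        exact hMat_nonneg M _ _ _
  exact h κ _

theorem superKostka_inl {M : ℕ} (κ : Diag M) (β : ℕ →₀ ℕ) :
    superKostka κ (Finsupp.mapDomain Sum.inl β) = (kostka κ.1 β : ℤ) := by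
  rw [superKostka, superProd, Finsupp.prod_mapDomain_index_inj Sum.inl_injective]
  exact (ncard_content_eq κ β).symm

theorem superKostka_inr {M : ℕ} (κ : Diag M) (γ : ℕ →₀ ℕ) :
    superKostka κ (Finsupp.mapDomain Sum.inr γ) = (kostka κ.1.transpose γ : ℤ) := by
  rw [superKostka, superProd, Finsupp.prod_mapDomain_index_inj Sum.inr_injective]
  exact (ncard_content_transpose_eq κ γ).symm

/-! ### Generating functions of strips -/

section StripSeries

variable (M : ℕ) {T T' : Type*} [CommRing T] [Algebra (StripRing M) T] [CommRing T']
  [Algebra (StripRing M) T']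

/-- The generating function of horizontal strips, or of vertical strips in the odd case. -/
noncomputable def stripSeries (odd : Bool) (z : T) : T :=
  ∑ a ∈ range (M + 1), algebraMap (StripRing M) T (strip M odd a) * z ^ a

theorem map_stripSeries (φ : T →ₐ[StripRing M] T') (o : Bool) (z : T) :
    φ (stripSeries M o z) = stripSeries M o (φ z) := by
  simp only [stripSeries, map_sum, map_mul, map_pow, AlgHom.commutes]

theorem stripSeries_zero (o : Bool) : stripSeries M o (0 : T) = 1 := by
  rw [stripSeries, sum_eq_single 0]
  · rw [strip_zero, map_one, pow_zero, mul_one]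
  · intro a _ ha
    rw [zero_pow ha, mul_zero]
  · intro h
    exact absurd (mem_range.2 (Nat.succ_pos M)) h

/-- The identity `H(z) E(-z) = 1`. Truncation at `M` is harmless because strips with more than `M`
boxes act as zero, so this is an identity of polynomials evaluated at `z`. -/
theorem stripSeries_mul_neg (z : T) :
    stripSeries M false z * stripSeries M true (-z) = 1 := by
  set f : Polynomial (StripRing M) :=
    ∑ a ∈ range (M + 1), Polynomial.monomial a (strip M false a) with hf
  set g : Polynomial (StripRing M) :=
    ∑ a ∈ range (M + 1), Polynomial.monomial a ((-1) ^ a * strip M true a) with hg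
  have hcoeff : ∀ c : ℕ → StripRing M, (∀ a, M < a → c a = 0) → ∀ n,
      (∑ a ∈ range (M + 1), Polynomial.monomial a (c a)).coeff n = c n := by
    intro c hc n
    rw [Polynomial.finsetSum_coeff]
    simp only [Polynomial.coeff_monomial]
    rw [sum_ite_eq', ite_eq_left_iff]
    intro h
    exact (hc n (by simpa using h)).symm
  have hfg : f * g = 1 := by
    ext n
    rw [Polynomial.coeff_mul, Polynomial.coeff_one]
    have h1 : ∀ p ∈ antidiagonal n, f.coeff p.1 * g.coeff p.2 =
        (-1) ^ p.2 * (strip M false p.1 * strip M true p.2) := fun p _ => by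
      rw [hf, hg, hcoeff _ fun a => strip_eq_zero _, hcoeff (fun a => (-1) ^ a * strip M true a)
        fun a h => by simp only [strip_eq_zero _ h, mul_zero]]
      ring
    rw [sum_congr rfl h1]
    split_ifs with hn
    · subst hn
      simp [strip_zero]
    · exact sum_strip_mul_strip M hn
  have e1 : Polynomial.aeval z f = stripSeries M false z := by
    rw [hf, map_sum]
    exact sum_congr rfl fun a _ => Polynomial.aeval_monomial _
  have e2 : Polynomial.aeval z g = stripSeries M true (-z) := by
    rw [hg, map_sum]
    refine sum_congr rfl fun a _ => ?_
    rw [Polynomial.aeval_monomial, map_mul, map_pow, map_neg, map_one, neg_pow z]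
    ring
  rw [← e1, ← e2, ← map_mul, hfg, map_one]

theorem stripSeries_mul_not (o : Bool) (z : T) :
    stripSeries M o z * stripSeries M (!o) (-z) = 1 := by
  cases o with
  | false => exact stripSeries_mul_neg M z
  | true =>
    have h := stripSeries_mul_neg M (-z)
    rw [neg_neg] at h
    rw [mul_comm]
    exact h

/-- Changing both the parity and the sign of the argument inverts the series. Every factor is thus a
power, with exponent `(-1)^(e p) * n p`, of one unit, and these exponents sum to zero. -/
theorem prod_stripSeries_eq_one {ι : Type*} (s : Finset ι) (o : Bool) (z : T) (e n : ι → ℕ)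
    (h : ∑ p ∈ s, (-1 : ℤ) ^ e p * (n p : ℤ) = 0) :
    ∏ p ∈ s, stripSeries M (o ^^ (e p).bodd) ((-1) ^ e p * z) ^ n p = 1 := by
  classical
  let u : Tˣ := ⟨stripSeries M o z, stripSeries M (!o) (-z), stripSeries_mul_not M o z, by
    rw [mul_comm]; exact stripSeries_mul_not M o z⟩
  have h1 : ∀ p, stripSeries M (o ^^ (e p).bodd) ((-1) ^ e p * z) ^ n p =
      ((u ^ ((-1 : ℤ) ^ e p * (n p : ℤ)) : Tˣ) : T) := by
    intro p
    rcases Nat.even_or_odd (e p) with he | he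
    · rw [he.neg_one_pow, he.neg_one_pow, one_mul, one_mul, zpow_natCast, Units.val_pow_eq_pow_val]
      have hb : (e p).bodd = false := by
        obtain ⟨r, hr⟩ := he
        rw [hr, Nat.bodd_add, Bool.xor_self]
      rw [hb, Bool.xor_false]
    · rw [he.neg_one_pow, he.neg_one_pow, neg_one_mul, neg_one_mul, zpow_neg, zpow_natCast,
        ← inv_pow, Units.val_pow_eq_pow_val]
      have hb : (e p).bodd = true := by
        obtain ⟨r, hr⟩ := he
        rw [hr, two_mul, Nat.bodd_add, Nat.bodd_add, Bool.xor_self, Nat.bodd_one, Bool.false_xor]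
      rw [hb, Bool.xor_true]
      rfl
  have h2 : ∀ s' : Finset ι, ∏ p ∈ s', u ^ ((-1 : ℤ) ^ e p * (n p : ℤ)) =
      u ^ ∑ p ∈ s', (-1 : ℤ) ^ e p * (n p : ℤ) := by
    intro s'
    induction s' using Finset.induction_on with
    | empty => simp
    | insert p s' hp ih => rw [prod_insert hp, sum_insert hp, zpow_add, ih]
  rw [prod_congr rfl fun p _ => h1 p, ← Units.coe_prod, h2, h, zpow_zero, Units.val_one]

end StripSeries

/-! ### The substitution of `-x_i` for `y_j` and its effect on exponents -/

section Specialization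

variable {R : Type*} [CommRing R] {A : Type*} {v w : A}

/-- The exponent of a monomial after the variable `w` is replaced by `v`. -/
noncomputable def moveExp (v w : A) (u : A →₀ ℕ) : A →₀ ℕ := u.erase w + Finsupp.single v (u w)

theorem moveExp_eq_iff (hvw : v ≠ w) {u δ : A →₀ ℕ} (hv : δ v = 0) (hw : δ w = 0) {d : ℕ} :
    moveExp v w u = δ + Finsupp.single v d ↔
      u v + u w = d ∧ u = δ + Finsupp.single v (u v) + Finsupp.single w (u w) := by
  constructor
  · intro h
    have h1 := DFunLike.congr_fun h v
    simp only [moveExp, Finsupp.add_apply, Finsupp.single_eq_same, hv, zero_add,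
      Finsupp.erase_ne hvw] at h1
    refine ⟨h1, ?_⟩
    ext x
    have h2 := DFunLike.congr_fun h x
    simp only [moveExp, Finsupp.add_apply] at h2 ⊢
    rcases eq_or_ne x w with rfl | hxw
    · rw [hw, Finsupp.single_eq_of_ne hvw.symm, Finsupp.single_eq_same]
      omega
    rcases eq_or_ne x v with rfl | hxv
    · rw [hv, Finsupp.single_eq_same, Finsupp.single_eq_of_ne hxw]
      omega
    · rw [Finsupp.single_eq_of_ne hxv, Finsupp.single_eq_of_ne hxv, Finsupp.erase_ne hxw] at h2
      rw [Finsupp.single_eq_of_ne hxv, Finsupp.single_eq_of_ne hxw]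
      omega
  · rintro ⟨h1, h2⟩
    ext x
    have h3 := DFunLike.congr_fun h2 x
    simp only [moveExp, Finsupp.add_apply] at h3 ⊢
    rcases eq_or_ne x w with rfl | hxw
    · rw [hw, Finsupp.erase_same, Finsupp.single_eq_of_ne hvw.symm,
        Finsupp.single_eq_of_ne hvw.symm]
    rcases eq_or_ne x v with rfl | hxv
    · rw [hv, Finsupp.single_eq_same, Finsupp.single_eq_same, Finsupp.erase_ne hxw]
      omega
    · rw [Finsupp.single_eq_of_ne hxv, Finsupp.single_eq_of_ne hxw] at h3
      rw [Finsupp.single_eq_of_ne hxv, Finsupp.single_eq_of_ne hxv, Finsupp.erase_ne hxw]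
      omega

/-- The substitution of `-X v` for the variable `X w`. -/
noncomputable def negSubst (R : Type*) [CommRing R] [DecidableEq A] (v w : A) :
    MvPolynomial A R →ₐ[R] MvPolynomial A R :=
  MvPolynomial.aeval fun x => if x = w then -MvPolynomial.X v else MvPolynomial.X x

theorem negSubst_monomial [DecidableEq A] (u : A →₀ ℕ) (c : R) : negSubst R v w (MvPolynomial.monomial u c) =
    (-1) ^ u w * MvPolynomial.monomial (moveExp v w u) c := by
  rw [negSubst, MvPolynomial.aeval_monomial, MvPolynomial.algebraMap_eq,
    ← Finsupp.mul_prod_erase' u w _ fun _ => pow_zero _, if_pos rfl, neg_pow, moveExp]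
  have h : (u.erase w).prod (fun x k => (if x = w then -MvPolynomial.X (R := R) v else
      MvPolynomial.X x) ^ k) = (u.erase w).prod fun x k => MvPolynomial.X x ^ k := by
    refine Finsupp.prod_congr fun x hx => ?_
    rw [if_neg]
    rintro rfl
    simp at hx
  rw [h, ← mul_one c, ← mul_one (c * 1), ← MvPolynomial.monomial_mul, MvPolynomial.monomial_eq,
    ← MvPolynomial.X_pow_eq_monomial]
  simp only [mul_one]
  ring

/-- The monomials that become `δ + single v d` distribute the exponent `d` between `v` and `w`. The
alternating sums defining `IsSuper` are therefore coefficients after the substitution. -/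
theorem coeff_negSubst [DecidableEq A] (hvw : v ≠ w) {δ : A →₀ ℕ} (hv : δ v = 0) (hw : δ w = 0) (d : ℕ)
    (f : MvPolynomial A R) :
    MvPolynomial.coeff (δ + Finsupp.single v d) (negSubst R v w f) =
      ∑ p ∈ antidiagonal d, (-1) ^ p.2 *
        MvPolynomial.coeff (δ + Finsupp.single v p.1 + Finsupp.single w p.2) f := by
  induction f using MvPolynomial.induction_on' with
  | add f g hf hg =>
    simp only [map_add, MvPolynomial.coeff_add, mul_add, sum_add_distrib, hf, hg]
  | monomial u c =>
    have hC : ((-1) ^ u w : MvPolynomial A R) = MvPolynomial.C ((-1) ^ u w) := by simp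
    rw [negSubst_monomial, hC, MvPolynomial.coeff_C_mul, MvPolynomial.coeff_monomial]
    simp only [moveExp_eq_iff hvw hv hw, MvPolynomial.coeff_monomial]
    split_ifs with h
    · rw [sum_eq_single (u v, u w), if_pos h.2]
      · rintro ⟨a, b⟩ _ hne
        rw [if_neg, mul_zero]
        intro hu
        apply hne
        have h1 := DFunLike.congr_fun hu v
        have h2 := DFunLike.congr_fun hu w
        simp only [Finsupp.add_apply, hv, hw, Finsupp.single_eq_same,
          Finsupp.single_eq_of_ne hvw, Finsupp.single_eq_of_ne hvw.symm] at h1 h2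
        exact Prod.ext (by simp only; omega) (by simp only; omega)
      · intro hc
        exact absurd (HasAntidiagonal.mem_antidiagonal.2 h.1) hc
    · rw [mul_zero]
      symm
      refine sum_eq_zero fun p hp => ?_
      rw [if_neg, mul_zero]
      intro hu
      apply h
      have h1 := DFunLike.congr_fun hu v
      have h2 := DFunLike.congr_fun hu w
      simp only [Finsupp.add_apply, hv, hw, Finsupp.single_eq_same,
        Finsupp.single_eq_of_ne hvw, Finsupp.single_eq_of_ne hvw.symm, zero_add, add_zero] at h1 h2
      rw [h1, h2]
      exact ⟨HasAntidiagonal.mem_antidiagonal.1 hp, hu⟩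

theorem coeff_eq_zero_of_mem_supported {f : MvPolynomial A R}
    (hf : f ∈ MvPolynomial.supported R {x | x ≠ v}) {δ : A →₀ ℕ} (hδ : δ v ≠ 0) :
    MvPolynomial.coeff δ f = 0 := by
  by_contra hc
  have h1 := MvPolynomial.mem_supported.1 hf
  have h2 : v ∈ f.vars :=
    (MvPolynomial.mem_vars_iff_mem_support v).2 ⟨δ, MvPolynomial.mem_support_iff.2 hc,
      Finsupp.mem_support_iff.2 hδ⟩
  exact h1 h2 rfl

theorem monomial_mem_supported {u : A →₀ ℕ} (h : u v = 0) (c : R) :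
    MvPolynomial.monomial u c ∈ MvPolynomial.supported R {x | x ≠ v} := by
  classical
  rw [MvPolynomial.mem_supported]
  intro x hx
  obtain ⟨s, hs, hxs⟩ := (MvPolynomial.mem_vars_iff_mem_support x).1 hx
  rw [MvPolynomial.mem_support_iff, MvPolynomial.coeff_monomial] at hs
  have hs' : u = s := by
    by_contra hne
    exact hs (if_neg hne)
  rintro rfl
  exact Finsupp.mem_support_iff.1 hxs (hs' ▸ h)

/-- A product over the exponents of degree `m` in a finite set of variables which become `u` if the
variable `w` is replaced by `v`. -/
theorem prod_moveExp_fiber [DecidableEq A] (hvw : v ≠ w) {V : Finset A} {m : ℕ} {u : A →₀ ℕ}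
    (hvV : v ∈ V) (hwV : w ∈ V) (hu : u ∈ finsuppAntidiag V m) (huw : u w = 0)
    {T : Type*} [CommMonoid T] (f : (A →₀ ℕ) → T) :
    ∏ x ∈ (finsuppAntidiag V m).filter (fun x => moveExp v w x = u), f x =
      ∏ p ∈ antidiagonal (u v),
        f (u.erase v + Finsupp.single v p.1 + Finsupp.single w p.2) := by
  have h0v : (u.erase v) v = 0 := Finsupp.erase_same
  have h0w : (u.erase v) w = 0 := by rw [Finsupp.erase_ne hvw.symm, huw]
  have key : ∀ x, moveExp v w x = u ↔ x v + x w = u v ∧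
      x = u.erase v + Finsupp.single v (x v) + Finsupp.single w (x w) := by
    intro x
    rw [← moveExp_eq_iff hvw h0v h0w, Finsupp.erase_add_single]
  refine prod_bij' (fun x _ => (x v, x w))
    (fun p _ => u.erase v + Finsupp.single v p.1 + Finsupp.single w p.2) ?_ ?_ ?_ ?_ ?_
  · intro x hx
    exact HasAntidiagonal.mem_antidiagonal.2 ((key x).1 (mem_filter.1 hx).2).1
  · intro p hp
    have hp := HasAntidiagonal.mem_antidiagonal.1 hp
    have e1 : (u.erase v + Finsupp.single v p.1 + Finsupp.single w p.2) v = p.1 := by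
      simp [Finsupp.single_eq_of_ne hvw]
    have e2 : (u.erase v + Finsupp.single v p.1 + Finsupp.single w p.2) w = p.2 := by
      simp [Finsupp.single_eq_of_ne hvw.symm, Finsupp.erase_ne hvw.symm, huw]
    refine mem_filter.2 ⟨?_, (key _).2 ⟨by rw [e1, e2, hp], by rw [e1, e2]⟩⟩
    rw [mem_finsuppAntidiag'] at hu ⊢
    have h1 : u.erase v + Finsupp.single v (u v) = u := Finsupp.erase_add_single v u
    constructor
    · have h2 := congrArg Finsupp.degree h1
      have h3 : u.degree = m := hu.1
      rw [map_add, Finsupp.degree_single] at h2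
      change Finsupp.degree _ = m
      rw [map_add, map_add, Finsupp.degree_single, Finsupp.degree_single]
      omega
    · refine Finsupp.support_add.trans (union_subset (Finsupp.support_add.trans
        (union_subset ?_ ?_)) ?_)
      · rw [Finsupp.support_erase]
        exact (erase_subset _ _).trans hu.2
      · exact Finsupp.support_single_subset.trans (singleton_subset_iff.2 hvV)
      · exact Finsupp.support_single_subset.trans (singleton_subset_iff.2 hwV)
  · intro x hx
    exact ((key x).1 (mem_filter.1 hx).2).2.symm
  · intro p _
    refine Prod.ext ?_ ?_
    · simp [Finsupp.single_eq_of_ne hvw]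
    · simp [Finsupp.single_eq_of_ne hvw.symm, Finsupp.erase_ne hvw.symm, huw]
  · intro x hx
    rw [← ((key x).1 (mem_filter.1 hx).2).2]

theorem moveExp_mem_finsuppAntidiag [DecidableEq A] {V : Finset A} {m : ℕ} {u : A →₀ ℕ} (hvV : v ∈ V)
    (hu : u ∈ finsuppAntidiag V m) : moveExp v w u ∈ finsuppAntidiag V m := by
  rw [mem_finsuppAntidiag'] at hu ⊢
  have h1 : u.erase w + Finsupp.single w (u w) = u := Finsupp.erase_add_single w u
  have h2 := congrArg Finsupp.degree h1
  have h3 : u.degree = m := hu.1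
  rw [map_add, Finsupp.degree_single] at h2
  constructor
  · change Finsupp.degree _ = m
    rw [moveExp, map_add, Finsupp.degree_single]
    omega
  · refine Finsupp.support_add.trans (union_subset ?_ ?_)
    · rw [Finsupp.support_erase]
      exact (erase_subset _ _).trans hu.2
    · exact Finsupp.support_single_subset.trans (singleton_subset_iff.2 hvV)

end Specialization

/-! ### The super plethysm -/

/-- The number of odd letters in a content. -/
noncomputable def oddDegree : (ℕ ⊕ ℕ →₀ ℕ) →+ ℕ :=
  Finsupp.liftAddHom fun v => bif v.isRight then AddMonoidHom.id ℕ else 0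

theorem oddDegree_inl (i a : ℕ) : oddDegree (Finsupp.single (Sum.inl i) a) = 0 := by
  rw [oddDegree, Finsupp.liftAddHom_apply_single]
  rfl

theorem oddDegree_inr (j a : ℕ) : oddDegree (Finsupp.single (Sum.inr j) a) = a := by
  rw [oddDegree, Finsupp.liftAddHom_apply_single]
  rfl

/-- The variables `x_i`, `y_j` with `i, j < k`. -/
def superVars (k : ℕ) : Finset (ℕ ⊕ ℕ) := (range k).disjSum (range k)

theorem inl_mem_superVars {i k : ℕ} : Sum.inl i ∈ superVars k ↔ i < k := by
  simp [superVars]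

theorem inr_mem_superVars {j k : ℕ} : Sum.inr j ∈ superVars k ↔ j < k := by
  simp [superVars]

/-- The generating function of the operators adding strips of sizes `α_t`, for all supertableaux
`t` of shape `μ` in the variables `x_i`, `y_j` with `i, j < k`. -/
noncomputable def superPleth (k : ℕ) {M : ℕ} (μ : Diag M) :
    MvPolynomial (ℕ ⊕ ℕ) (StripRing M) :=
  ∏ u ∈ finsuppAntidiag (superVars k) μ.1.card,
    stripSeries M (oddDegree u).bodd (MvPolynomial.monomial u (1 : StripRing M)) ^
      (superKostka μ u).toNat

/-- Supersymmetry of the product: factors are grouped by their monomial after the substitution. A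
group whose monomial involves `x_i` multiplies to `1`; the remaining groups do not involve `x_i`. -/
theorem negSubst_superPleth_mem {k M : ℕ} (μ : Diag M) {i j : ℕ} (hi : i < k) (hj : j < k) :
    negSubst (StripRing M) (Sum.inl i) (Sum.inr j) (superPleth k μ) ∈
      MvPolynomial.supported (StripRing M) {x | x ≠ Sum.inl i} := by
  have hvw : (Sum.inl i : ℕ ⊕ ℕ) ≠ Sum.inr j := Sum.inl_ne_inr
  have hvV := inl_mem_superVars.2 hi
  have hwV := inr_mem_superVars.2 hj
  rw [superPleth, map_prod, ← prod_fiberwise_of_maps_to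
    (g := moveExp (Sum.inl i) (Sum.inr j)) (t := finsuppAntidiag (superVars k) μ.1.card)
    fun u hu => moveExp_mem_finsuppAntidiag hvV hu]
  refine Subalgebra.prod_mem _ fun u hu => ?_
  -- The substitution leaves no `y_j`, so exponents containing it have an empty group.
  by_cases huw : u (Sum.inr j) = 0
  swap
  · rw [filter_false_of_mem, prod_empty]
    · exact one_mem _
    · rintro x - rfl
      simp [moveExp] at huw
  by_cases huv : u (Sum.inl i) = 0
  · refine Subalgebra.prod_mem _ fun x hx => ?_
    obtain ⟨hx1, hx2⟩ := mem_filter.1 hx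
    have h0 := DFunLike.congr_fun hx2 (Sum.inl i)
    simp only [moveExp, Finsupp.add_apply, Finsupp.single_eq_same, huv] at h0
    have hxu : x (Sum.inr j) = 0 := by omega
    rw [map_pow, map_stripSeries, negSubst_monomial, hxu, pow_zero, one_mul, hx2]
    refine Subalgebra.pow_mem _ (Subalgebra.sum_mem _ fun a _ => ?_) _
    exact Subalgebra.mul_mem _ (Subalgebra.algebraMap_mem _ _)
      (Subalgebra.pow_mem _ (monomial_mem_supported huv _) _)
  · rw [prod_moveExp_fiber hvw hvV hwV hu huw]
    set u0 := u.erase (Sum.inl i) with hu0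
    have h0v : u0 (Sum.inl i) = 0 := Finsupp.erase_same
    have h0w : u0 (Sum.inr j) = 0 := by rw [hu0, Finsupp.erase_ne hvw.symm, huw]
    have hw : ∀ p : ℕ × ℕ, (u0 + Finsupp.single (Sum.inl i) p.1 +
        Finsupp.single (Sum.inr j) p.2 : ℕ ⊕ ℕ →₀ ℕ) (Sum.inr j) = p.2 := fun p => by
      simp [h0w]
    have hv : ∀ p : ℕ × ℕ, (u0 + Finsupp.single (Sum.inl i) p.1 +
        Finsupp.single (Sum.inr j) p.2 : ℕ ⊕ ℕ →₀ ℕ) (Sum.inl i) = p.1 := fun p => by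
      simp [h0v]
    -- The members of a group differ by how many copies of `x_i` became `y_j`. Each such change
    -- flips the parity and contributes a sign, and the multiplicities have alternating sum zero by
    -- `superKostka_rel`.
    have hone := prod_stripSeries_eq_one M (antidiagonal (u (Sum.inl i))) (oddDegree u0).bodd
      (MvPolynomial.monomial u (1 : StripRing M)) (fun p => p.2) (fun p => (superKostka μ
        (u0 + Finsupp.single (Sum.inl i) p.1 + Finsupp.single (Sum.inr j) p.2)).toNat) (by
        rw [← superKostka_rel μ h0v h0w huv]
        exact sum_congr rfl fun p _ => by rw [Int.toNat_of_nonneg (superKostka_nonneg _ _)])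
    rw [prod_congr rfl, hone]
    · exact one_mem _
    · intro p hp
      have hmove : moveExp (Sum.inl i) (Sum.inr j) (u0 + Finsupp.single (Sum.inl i) p.1 +
          Finsupp.single (Sum.inr j) p.2) = u := by
        conv_rhs => rw [← Finsupp.erase_add_single (Sum.inl i) u]
        rw [moveExp_eq_iff hvw h0v h0w, hw, hv]
        exact ⟨HasAntidiagonal.mem_antidiagonal.1 hp, rfl⟩
      rw [map_pow, map_stripSeries, negSubst_monomial, hmove, hw, map_add, map_add, oddDegree_inl,
        oddDegree_inr, add_zero, Nat.bodd_add]

theorem sumElim_add_single (β γ : ℕ →₀ ℕ) (i j a b : ℕ) :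
    Finsupp.sumElim (β + Finsupp.single i a) (γ + Finsupp.single j b) =
      Finsupp.sumElim β γ + Finsupp.single (Sum.inl i) a + Finsupp.single (Sum.inr j) b := by
  classical
  ext x
  cases x <;> simp [Finsupp.single_apply]

/-- The alternating sum is the coefficient of a monomial containing `x_i` in a polynomial that no
longer involves `x_i`. -/
theorem isSuper_superPleth (k : ℕ) {M : ℕ} (μ ν : Diag M) :
    IsSuper k fun β γ => StripRing.val M
      (MvPolynomial.coeff (Finsupp.sumElim β γ) (superPleth k μ)) ν (Diag.empty M) := by
  intro i hi j hj β γ hβ hγ d hd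
  have hv : (Finsupp.sumElim β γ) (Sum.inl i) = 0 := by simpa using hβ
  have hw : (Finsupp.sumElim β γ) (Sum.inr j) = 0 := by simpa using hγ
  have h1 := coeff_negSubst (R := StripRing M) Sum.inl_ne_inr hv hw d (superPleth k μ)
  rw [coeff_eq_zero_of_mem_supported (negSubst_superPleth_mem μ hi hj)
    (by simpa [hβ] using hd)] at h1
  have h := congrArg (fun x => StripRing.val M x ν (Diag.empty M)) h1
  simp only [map_zero, Matrix.zero_apply, map_sum, Matrix.sum_apply] at h
  rw [h]
  refine sum_congr rfl fun p _ => ?_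
  beta_reduce
  rw [sumElim_add_single, map_mul (StripRing.val M) ((-1) ^ p.2), map_pow, map_neg, map_one]
  rcases Nat.even_or_odd p.2 with h | h <;> simp [h.neg_one_pow]

theorem isSuper_superKostka (k : ℕ) {M : ℕ} (κ : Diag M) :
    IsSuper k fun β γ => superKostka κ (Finsupp.sumElim β γ) := by
  intro i _ j _ β γ hβ hγ d hd
  rw [← superKostka_rel κ (δ := Finsupp.sumElim β γ) (i := i) (j := j) (by simpa using hβ)
    (by simpa using hγ) hd]
  exact sum_congr rfl fun p _ => by beta_reduce; rw [sumElim_add_single]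

/-! ### Reading ordinary plethysms off the super plethysm -/

section Extraction

/-- The coefficients of a product of generating functions of strips. -/
theorem coeff_prod_stripSeries {M : ℕ} {I : Type*} (s : Finset I) (w : I → ℕ →₀ ℕ) (o : Bool)
    (β : ℕ →₀ ℕ) :
    MvPolynomial.coeff β (∏ t ∈ s,
      stripSeries M o (MvPolynomial.monomial (w t) (1 : StripRing M))) =
    ∑ α ∈ s.finsupp fun _ => range (M + 1),
      if (α.sum fun t k => k • w t) = β then α.prod fun _ a => strip M o a else 0 := by
  classical
  simp only [stripSeries]
  rw [prod_sum, Finset.finsupp, sum_map, MvPolynomial.coeff_sum]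
  refine sum_congr rfl fun p hp => ?_
  set α : I →₀ ℕ := Finsupp.indicator s p with hα
  have hsupp : α.support ⊆ s := Finsupp.support_indicator_subset _ _
  have h1 : ∏ x ∈ s.attach, algebraMap (StripRing M) (MvPolynomial ℕ (StripRing M))
      (strip M o (p x.1 x.2)) * MvPolynomial.monomial (w x.1) (1 : StripRing M) ^ p x.1 x.2 =
      ∏ x ∈ s, algebraMap (StripRing M) (MvPolynomial ℕ (StripRing M))
      (strip M o (α x)) * MvPolynomial.monomial (w x) (1 : StripRing M) ^ α x := by
    rw [← prod_attach s]
    refine prod_congr rfl fun x _ => ?_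
    rw [hα, Finsupp.indicator_of_mem x.2]
  have h2 : ∀ x, algebraMap (StripRing M) (MvPolynomial ℕ (StripRing M))
      (strip M o (α x)) * MvPolynomial.monomial (w x) (1 : StripRing M) ^ α x =
      MvPolynomial.monomial (α x • w x) (strip M o (α x)) := by
    intro x
    rw [MvPolynomial.algebraMap_eq, MvPolynomial.monomial_pow, one_pow, MvPolynomial.C_mul_monomial,
      mul_one]
  have h3 : ∀ s' : Finset I, ∏ x ∈ s', MvPolynomial.monomial (α x • w x) (strip M o (α x)) =
      MvPolynomial.monomial (∑ x ∈ s', α x • w x) (∏ x ∈ s', strip M o (α x)) := by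
    intro s'
    induction s' using Finset.induction_on with
    | empty => rfl
    | insert x s' hx ih =>
      rw [prod_insert hx, ih, MvPolynomial.monomial_mul, sum_insert hx, prod_insert hx]
  rw [h1, prod_congr rfl fun x _ => h2 x, h3, MvPolynomial.coeff_monomial,
    ← Finsupp.sum_of_support_subset α hsupp (fun t k => k • w t) fun _ _ => zero_smul _ _,
    ← Finsupp.prod_of_support_subset α hsupp (fun _ a => strip M o a) fun _ _ => strip_zero _ _]
  rfl

/-- The shape whose tableaux are the supertableaux of shape `μ` with odd letters only. -/
def twist (o : Bool) (μ : YoungDiagram) : YoungDiagram := bif o then μ.transpose else μ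

theorem card_twist (o : Bool) (μ : YoungDiagram) : (twist o μ).card = μ.card := by
  cases o
  · rfl
  · exact card_transpose μ

theorem ncard_content_twist_eq {B : Type*} [LinearOrder B] {M : ℕ} (o : Bool) (κ : Diag M)
    (α : B →₀ ℕ) : ({t : SSYT (twist o κ.1) B | t.content = α}.ncard : ℤ) =
      StripRing.val M (α.prod fun _ a => strip M o a) κ (Diag.empty M) := by
  cases o
  · exact ncard_content_eq κ α
  · exact ncard_content_transpose_eq κ α

/-- The variables of given parity. -/
def letter (o : Bool) (i : ℕ) : ℕ ⊕ ℕ := bif o then Sum.inr i else Sum.inl i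

theorem letter_injective (o : Bool) : Function.Injective (letter o) := by
  cases o
  · exact Sum.inl_injective
  · exact Sum.inr_injective

theorem superKostka_letter {M : ℕ} (o : Bool) (κ : Diag M) (β : ℕ →₀ ℕ) :
    superKostka κ (Finsupp.mapDomain (letter o) β) = (kostka (twist o κ.1) β : ℤ) := by
  cases o
  · exact superKostka_inl κ β
  · exact superKostka_inr κ β

theorem oddDegree_letter (o : Bool) (β : ℕ →₀ ℕ) :
    oddDegree (Finsupp.mapDomain (letter o) β) = bif o then β.degree else 0 := by
  induction β using Finsupp.induction_linear with
  | zero => cases o <;> simp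
  | add f g hf hg => rw [Finsupp.mapDomain_add, map_add, hf, hg]; cases o <;> simp
  | single i a =>
    rw [Finsupp.mapDomain_single]
    cases o
    · exact oddDegree_inl i a
    · rw [Finsupp.degree_single]
      exact oddDegree_inr i a

theorem mapDomain_letter_mem {o : Bool} {k m : ℕ} {β : ℕ →₀ ℕ} :
    Finsupp.mapDomain (letter o) β ∈ finsuppAntidiag (superVars k) m ↔
      β ∈ finsuppAntidiag (range k) m := by
  classical
  rw [mem_finsuppAntidiag', mem_finsuppAntidiag']
  change Finsupp.degree _ = m ∧ _ ↔ Finsupp.degree _ = m ∧ _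
  rw [Finsupp.degree_mapDomain, Finsupp.mapDomain_support_of_injective (letter_injective o)]
  refine and_congr_right fun _ => ?_
  simp only [subset_iff, mem_image, forall_exists_index, and_imp, forall_apply_eq_imp_iff₂]
  refine forall₂_congr fun i _ => ?_
  cases o
  · exact inl_mem_superVars.trans mem_range.symm
  · exact inr_mem_superVars.trans mem_range.symm

/-- The part of the super plethysm in variables of given parity. -/
theorem killCompl_superPleth (k : ℕ) {M : ℕ} (μ : Diag M) (o : Bool) :
    MvPolynomial.killCompl (letter_injective o) (superPleth k μ) =
      ∏ w ∈ finsuppAntidiag (range k) μ.1.card,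
        stripSeries M (o && μ.1.card.bodd) (MvPolynomial.monomial w (1 : StripRing M)) ^
          kostka (twist o μ.1) w := by
  classical
  have hinj : Function.Injective (Finsupp.mapDomain (M := ℕ) (letter o)) :=
    Finsupp.mapDomain_injective (letter_injective o)
  have hsub : (finsuppAntidiag (range k) μ.1.card).image (Finsupp.mapDomain (letter o)) ⊆
      finsuppAntidiag (superVars k) μ.1.card := by
    intro u hu
    obtain ⟨w, hw, rfl⟩ := mem_image.1 hu
    exact mapDomain_letter_mem.2 hw
  rw [superPleth, map_prod, ← prod_subset hsub]
  · rw [prod_image fun _ _ _ _ h => hinj h]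
    refine prod_congr rfl fun w hw => ?_
    rw [map_pow, map_stripSeries, MvPolynomial.killCompl_monomial_mapDomain, superKostka_letter,
      Int.toNat_natCast, oddDegree_letter]
    have hdeg : w.degree = μ.1.card := (mem_finsuppAntidiag'.1 hw).1
    rw [hdeg]
    cases o
    · rw [cond_false, Nat.bodd_zero, Bool.false_and]
    · rfl
  -- A monomial with a letter of the other parity is sent to zero, and the strip series at zero is
  -- `1`, so its factor disappears.
  · intro u hu hu'
    rw [map_pow, map_stripSeries, MvPolynomial.killCompl_monomial_eq_zero_of_not_subset,
      stripSeries_zero, one_pow]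
    intro hc
    have hw := Finsupp.mapDomain_comapDomain (letter o) (letter_injective o) u hc
    rw [← hw] at hu hu'
    exact hu' (mem_image_of_mem _ (mapDomain_letter_mem.1 hu))

/-- Kostka numbers as exponents are traded for one factor per tableau, as in the variables of the
plethysm. -/
theorem prod_pow_kostka {k : ℕ} (κ : YoungDiagram) {T : Type*} [CommMonoid T]
    (f : (ℕ →₀ ℕ) → T) : ∃ s : Finset (SSYT κ ℕ),
      (∀ t, t ∈ s ↔ t.content.support ⊆ range k) ∧
      ∏ w ∈ finsuppAntidiag (range k) κ.card, f w ^ kostka κ w = ∏ t ∈ s, f t.content := by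
  classical
  have hmem : ∀ t : SSYT κ ℕ, t.content ∈ finsuppAntidiag (range k) κ.card ↔
      t.content.support ⊆ range k := by
    intro t
    rw [mem_finsuppAntidiag']
    exact and_iff_right t.degree_content
  have hfin : {t : SSYT κ ℕ | t.content.support ⊆ range k}.Finite := by
    refine Set.Finite.subset ((finsuppAntidiag (range k) κ.card).finite_toSet.biUnion
      fun w _ => SSYT.finite_content_eq w) fun t ht => ?_
    exact Set.mem_biUnion (mem_coe.2 ((hmem t).2 ht)) rfl
  refine ⟨hfin.toFinset, fun t => hfin.mem_toFinset, ?_⟩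
  rw [← prod_fiberwise_of_maps_to (g := SSYT.content)
    (t := finsuppAntidiag (range k) κ.card) fun t ht => (hmem t).2 (hfin.mem_toFinset.1 ht)]
  refine prod_congr rfl fun w hw => ?_
  rw [prod_congr rfl (g := fun _ => f w) fun t ht => by rw [(mem_filter.1 ht).2], prod_const,
    kostka, ← Set.ncard_coe_finset]
  congr 2
  ext t
  simp only [Set.mem_ofPred_eq, coe_filter, Set.Finite.mem_toFinset]
  constructor
  · rintro rfl
    exact ⟨(hmem t).1 hw, rfl⟩
  · exact fun h => h.2

/-- The coefficients of the super plethysm in variables of given parity. -/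
theorem coeff_superPleth_letter {k M : ℕ} (μ ν : Diag M) (o : Bool) {β : ℕ →₀ ℕ}
    (hβ : β.support ⊆ range k) :
    StripRing.val M (MvPolynomial.coeff (Finsupp.mapDomain (letter o) β) (superPleth k μ)) ν
      (Diag.empty M) =
    plethysm (schur (twist (o && μ.1.card.bodd) ν.1)) (twist o μ.1) β := by
  classical
  rw [← MvPolynomial.coeff_killCompl (letter_injective o), killCompl_superPleth]
  obtain ⟨s, hs, hprod⟩ := prod_pow_kostka (k := k) (twist o μ.1) fun w =>
    stripSeries M (o && μ.1.card.bodd) (MvPolynomial.monomial w (1 : StripRing M))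
  rw [card_twist] at hprod
  rw [hprod, coeff_prod_stripSeries, plethysm_apply_eq_finsum,
    finsum_eq_sum_of_support_subset (s := s.finsupp fun _ => range (M + 1)), map_sum,
    Matrix.sum_apply]
  · refine sum_congr rfl fun α _ => ?_
    rw [finsum_eq_if]
    split_ifs with h
    · exact (ncard_content_twist_eq _ ν α).symm
    · rw [map_zero, Matrix.zero_apply]
  -- The infinite sum reduces to the finite index set: tableaux that occur use only letters of `β`,
  -- and multiplicities above `M` give zero operators.
  · intro α hα
    rw [Function.mem_support, finsum_eq_if] at hα
    by_cases h : (α.sum fun t k => k • t.content) = β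
    · rw [if_pos h, ncard_content_twist_eq] at hα
      have hne : α.prod (fun _ a => strip M (o && μ.1.card.bodd) a) ≠ 0 := by
        intro hc
        rw [hc, map_zero, Matrix.zero_apply] at hα
        exact hα rfl
      rw [mem_coe, mem_finsupp_iff]
      refine ⟨fun t ht => (hs t).2 (subset_trans (fun b hb => ?_) hβ), fun t _ => ?_⟩
      · rw [← h, Finsupp.mem_support_iff, Finsupp.sum, Finsupp.finsetSum_apply]
        intro hc
        have h1 := sum_eq_zero_iff.1 hc t ht
        rw [Finsupp.smul_apply, smul_eq_mul, mul_eq_zero] at h1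
        exact h1.elim (Finsupp.mem_support_iff.1 ht) (Finsupp.mem_support_iff.1 hb)
      · rw [mem_range, Nat.lt_succ_iff]
        by_contra! hlt
        refine hne (prod_eq_zero (i := t) (Finsupp.mem_support_iff.2 (by omega)) ?_)
        exact strip_eq_zero _ hlt
    · rw [if_neg h] at hα
      exact absurd rfl hα

end Extraction

/-! ### The sign twist of a plethysm -/

theorem IsSuper.sub {k : ℕ} {D D' : (ℕ →₀ ℕ) → (ℕ →₀ ℕ) → ℤ} (h : IsSuper k D)
    (h' : IsSuper k D') : IsSuper k fun β γ => D β γ - D' β γ := by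
  intro i hi j hj β γ hβ hγ d hd
  simp only [mul_sub, sum_sub_distrib]
  rw [h i hi j hj β γ hβ hγ d hd, h' i hi j hj β γ hβ hγ d hd, sub_zero]

theorem IsSuper.sum {k : ℕ} {ι : Type*} (s : Finset ι) (c : ι → ℤ)
    {D : ι → (ℕ →₀ ℕ) → (ℕ →₀ ℕ) → ℤ} (h : ∀ x, IsSuper k (D x)) :
    IsSuper k fun β γ => ∑ x ∈ s, c x * D x β γ := by
  intro i hi j hj β γ hβ hγ d hd
  simp only [mul_sum]
  rw [sum_comm]
  refine sum_eq_zero fun x _ => ?_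
  simp only [mul_left_comm _ (c x)]
  rw [← mul_sum, h x i hi j hj β γ hβ hγ d hd, mul_zero]

theorem sumElim_zero_right (β : ℕ →₀ ℕ) :
    Finsupp.sumElim β (0 : ℕ →₀ ℕ) = Finsupp.mapDomain (letter false) β := by
  ext x
  cases x with
  | inl i => exact (Finsupp.mapDomain_apply (letter_injective false) β i).symm
  | inr j => exact (Finsupp.mapDomain_of_notMem_range β _ (by rintro ⟨i, hi⟩; cases hi)).symm

theorem sumElim_zero_left (γ : ℕ →₀ ℕ) :
    Finsupp.sumElim (0 : ℕ →₀ ℕ) γ = Finsupp.mapDomain (letter true) γ := by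
  ext x
  cases x with
  | inl i => exact (Finsupp.mapDomain_of_notMem_range γ _ (by rintro ⟨i, hi⟩; cases hi)).symm
  | inr j => exact (Finsupp.mapDomain_apply (letter_injective true) γ j).symm

theorem sum_eq_sum_diag {a : YoungDiagram →₀ ℤ} {M : ℕ} (ha : ∀ κ, a κ ≠ 0 → κ.card ≤ M)
    (f : YoungDiagram → ℤ) : (a.sum fun κ z => z * f κ) = ∑ κ : Diag M, a κ.1 * f κ.1 := by
  classical
  rw [← sum_image (s := univ) (f := fun κ => a κ * f κ) (g := fun κ : Diag M => κ.1)
    fun _ _ _ _ h => Subtype.ext h]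
  refine sum_subset (fun κ hκ => ?_) fun κ _ hκ => ?_
  · exact mem_image.2 ⟨⟨κ, ha κ (Finsupp.mem_support_iff.1 hκ)⟩, mem_univ _, rfl⟩
  · beta_reduce
    rw [Finsupp.notMem_support_iff.1 hκ, zero_mul]

theorem twist_bodd_eq_signTwist (μ ν : YoungDiagram) :
    twist (true && μ.card.bodd) ν = signTwist μ ν := by
  rw [signTwist, Bool.true_and]
  have h := Nat.mod_two_of_bodd μ.card
  split_ifs with he
  · rw [Nat.even_iff.1 he] at h
    cases hb : μ.card.bodd
    · rfl
    · rw [hb] at h; exact absurd h (by decide)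
  · rw [Nat.not_even_iff.1 he] at h
    cases hb : μ.card.bodd
    · rw [hb] at h; exact absurd h (by decide)
    · rfl

/-- The sign twist replaces all Schur functions in a plethysm by those of the conjugate
partitions. -/
theorem schurSum_transpose_eq_plethysm {μ ν : YoungDiagram} {a : YoungDiagram →₀ ℤ}
    (ha : schurSum a = plethysm (schur ν) μ) :
    schurSum (Finsupp.equivMapDomain YoungDiagram.transposeOrderIso.toEquiv a) =
      plethysm (schur (signTwist μ ν)) μ.transpose := by
  obtain ⟨b, hb, hcard⟩ := exists_schurSum_eq_plethysm μ ν
  obtain rfl := schurSum_injective (hb.trans ha.symm)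
  -- Large enough for `μ`, `ν` and all constituents, of size `μ.card * ν.card`, to be diagrams with
  -- at most `M` boxes.
  set M := μ.card + ν.card + μ.card * ν.card
  have hM : ∀ κ, b κ ≠ 0 → κ.card ≤ M := fun κ hκ => by rw [hcard κ hκ]; omega
  set m : Diag M := ⟨μ, by omega⟩
  set n : Diag M := ⟨ν, by omega⟩
  funext β
  obtain ⟨r, hr⟩ := exists_support_subset_range β
  -- At least `β.degree` even variables are needed, since `IsSuper.eq_zero` is applied at
  -- `x`-exponent `0` and `y`-exponent `β`, where all `k` of them are fresh.
  set k := max r β.degree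
  have hβ : β.support ⊆ range k := hr.trans (range_subset_range.2 (le_max_left _ _))
  have hsuper := (isSuper_superPleth k m n).sub (IsSuper.sum univ (fun κ : Diag M => b κ.1)
    fun κ => isSuper_superKostka k κ)
  have h := hsuper.eq_zero (fun γ hγ => ?_) 0 β (by simp) hβ (by simp [k])
  · rw [sumElim_zero_left, coeff_superPleth_letter m n true hβ, twist_bodd_eq_signTwist,
      sub_eq_zero] at h
    refine Eq.trans ?_ h.symm
    rw [schurSum_apply, Finsupp.sum_equivMapDomain]
    refine (sum_eq_sum_diag hM fun κ => (kostka κ.transpose β : ℤ)).trans ?_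
    exact sum_congr rfl fun κ _ => by rw [superKostka_letter]; rfl
  · rw [sumElim_zero_right, coeff_superPleth_letter m n false hγ, sub_eq_zero]
    refine (congrFun hb γ).symm.trans ?_
    rw [schurSum_apply]
    refine (sum_eq_sum_diag hM fun κ => (kostka κ γ : ℤ)).trans ?_
    exact sum_congr rfl fun κ _ => by rw [superKostka_letter]; rfl

/-- Conjugation is an order-reversing involution for dominance. -/
theorem mem_minimalPartitions_iff {S S' : Set YoungDiagram} (h : ∀ κ, κ ∈ S ↔ κ.transpose ∈ S')
    {κ : YoungDiagram} : κ ∈ minimalPartitions S ↔ κ.transpose ∈ maximalPartitions S' := by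
  unfold minimalPartitions maximalPartitions
  simp only [Set.mem_ofPred_eq, h]
  refine and_congr_right fun _ => ⟨fun h1 ρ hρ hd => ?_, fun h1 ρ hρ hd => ?_⟩
  · have h2 := h1 ρ.transpose (by rwa [YoungDiagram.transpose_transpose])
      (by rwa [← dominates_transpose_iff, YoungDiagram.transpose_transpose])
    rw [← h2, YoungDiagram.transpose_transpose]
  · exact YoungDiagram.transpose_eq_iff.1 (h1 ρ.transpose hρ hd.transpose)

end Plethysm

/-! ### The theorem -/

open Plethysm
theorem theorem4 (μ ν : YoungDiagram) :
    -- the maximal constituents are the maximal weights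
    parts '' maximalPartitions (constituents (plethysm (schur ν) μ)) = maximalWeights μ ν ∧
    -- their multiplicities
    (∀ κ ∈ maximalPartitions (constituents (plethysm (schur ν) μ)),
      hallInner (plethysm (schur ν) μ) (schur κ) = (numPSSYT μ ν (parts κ) : ℤ)) ∧
    -- the minimal constituents, up to conjugation, are the maximal weights for the sign twist
    (fun κ : YoungDiagram => parts κ.transpose) ''
        minimalPartitions (constituents (plethysm (schur ν) μ)) =
      maximalWeights μ.transpose (signTwist μ ν) ∧
    -- their multiplicities
    (∀ κ ∈ minimalPartitions (constituents (plethysm (schur ν) μ)),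
      hallInner (plethysm (schur ν) μ) (schur κ) =
        (numPSSYT μ.transpose (signTwist μ ν) (parts κ.transpose) : ℤ)) := by
  obtain ⟨a, ha, -⟩ := exists_schurSum_eq_plethysm μ ν
  have ha' := schurSum_transpose_eq_plethysm ha
  set a' := Finsupp.equivMapDomain YoungDiagram.transposeOrderIso.toEquiv a with hdef
  have happ : ∀ κ, a' κ.transpose = a κ := fun κ => by
    rw [hdef, Finsupp.equivMapDomain_apply]
    exact congrArg a (YoungDiagram.transpose_transpose κ)
  -- The Schur coefficients of the twisted plethysm are those of the original at conjugate
  -- partitions, so the statements on minimal constituents are the maximal ones for the twist.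
  have hmem : ∀ κ, κ ∈ constituents (plethysm (schur ν) μ) ↔ κ.transpose ∈
      constituents (plethysm (schur (signTwist μ ν)) μ.transpose) := fun κ => by
    rw [← ha, ← ha', constituents_schurSum, constituents_schurSum, Set.mem_ofPred_eq,
      Set.mem_ofPred_eq, happ]
  refine ⟨parts_image_maximal_constituents μ ν, fun κ hκ => hallInner_of_maximal hκ, ?_,
    fun κ hκ => ?_⟩
  · rw [← parts_image_maximal_constituents]
    ext β
    constructor
    · rintro ⟨κ, hκ, rfl⟩
      exact ⟨_, (mem_minimalPartitions_iff hmem).1 hκ, rfl⟩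
    · rintro ⟨κ, hκ, rfl⟩
      refine ⟨κ.transpose, (mem_minimalPartitions_iff hmem).2 ?_, ?_⟩
      · rwa [YoungDiagram.transpose_transpose]
      · exact congrArg parts (YoungDiagram.transpose_transpose κ)
  · rw [← hallInner_of_maximal ((mem_minimalPartitions_iff hmem).1 hκ), ← ha, ← ha',
      hallInner_schurSum, hallInner_schurSum, happ]
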